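/- All logarithms are to base $2$. Let $d\ge 2$ and work on $\mathbb{C}^d\otimes\mathbb{C}^d$ (systems $A$ and $B$). Put $|\Phi^+\rangle=\frac{1}{\sqrt d}\sum_{i=0}^{d-1}|i\rangle\otimes|i\rangle$ and $\Phi^+=|\Phi^+\rangle\langle\Phi^+|$. A state is a positive semidefinite operator of trace one. A state $\rho_{AB}$ is maximally correlated (MC) if there are orthonormal bases $\{|i\rangle_A\}$, $\{|i\rangle_B\}$ of $\mathbb{C}^d$ and a positive semidefinite matrix $(\alpha_{ij})$ of trace one with $\rho_{AB}=\sum_{i,j}\alpha_{ij}|i\rangle\langle j|_A\otimes|i\rangle\langle j|_B$. A state $\sigma_{AB}$ is PPT if its partial transpose on $B$ is positive semidefinite. With $S(\rho)=-\mathrm{tr}(\rho\log\rho)$, the coherent information is $I(A\rangle B)_\rho=S(\rho_B)-S(\rho_{AB})$, where $\rho_B=\mathrm{tr}_A\rho_{AB}$. The relative entropy is $D(\rho\|\sigma)=\mathrm{tr}(\rho(\log\rho-\log\sigma))$ if $\mathrm{supp}\,\rho\subseteq\mathrm{supp}\,\sigma$ and $+\infty$ otherwise, and the PPT-relative entropy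 of entanglement is $E_R^{\mathrm{PPT}}(\rho)=\min_{\sigma\ \mathrm{PPT}}D(\rho\|\sigma)$. For $f\in[0,1]$ let $I_d(f)=f\,\Phi^+ +\frac{1-f}{d^2-1}(\mathbb{1}-\Phi^+)$ be the isotropic state, and let $h(f)=-f\log f-(1-f)\log(1-f)$. Then for every $f\in[0,1]$ $$\varphi_G(f):=\inf\{I(A\rangle B)_\rho:\ \rho_{AB}\in\mathrm{MC},\ \langle\Phi^+|\rho_{AB}|\Phi^+\rangle=f\}=E_R^{\mathrm{PPT}}(I_d(f)),$$ where the minimum defining $E_R^{\mathrm{PPT}}(I_d(f))$ is attained, and $$E_R^{\mathrm{PPT}}(I_d(f))=\begin{cases}\log d-(1-f)\log(d-1)-h(f), & \tfrac1d\le f\le 1,\\ 0, & 0\le f\le\tfrac1d.\end{cases}$$ In particular, $\varphi_G$ is (finite and) convex on $[0,1]$. -/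

import Mathlib

open scoped Kronecker ComplexOrder

noncomputable section

namespace Entanglement

/-- Operators on a finite-dimensional Hilbert space `ℂ^n`, in the computational basis. -/
abbrev Op (n : Type*) := Matrix n n ℂ

/-- A quantum state: a positive semidefinite operator of trace one. -/
def IsState {n : Type*} [Fintype n] (ρ : Op n) : Prop :=
  ρ.PosSemidef ∧ ρ.trace = 1

/-- The base-2 logarithm of a Hermitian operator, by functional calculus. Since
`Real.logb 2 0 = 0`, the logarithm of a positive semidefinite operator is taken on its support
and vanishes on its kernel (the convention `0 log 0 = 0`). -/
def opLog {n : Type*} [Fintype n] [DecidableEq n] (ρ : Op n) : Op n :=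
  cfc (Real.logb 2) ρ

/-- The von Neumann entropy `S(ρ) = -tr (ρ log ρ)`. -/
def entropy {n : Type*} [Fintype n] [DecidableEq n] (ρ : Op n) : ℝ :=
  -(ρ * opLog ρ).trace.re

open scoped Classical in
/-- The relative entropy `D(ρ‖σ) = tr (ρ (log ρ - log σ))` if `supp ρ ⊆ supp σ`, and `+∞`
otherwise. The inclusion of the supports (the orthogonal complements of the kernels) is expressed
as `ker σ ⊆ ker ρ`. -/
def relEntropy {n : Type*} [Fintype n] [DecidableEq n] (ρ σ : Op n) : EReal :=
  if LinearMap.ker σ.mulVecLin ≤ LinearMap.ker ρ.mulVecLin then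
    (((ρ * (opLog ρ - opLog σ)).trace.re : ℝ) : EReal)
  else ⊤

/-- The marginal `ρ_B = tr_A ρ_AB`. -/
def marginalB {d : ℕ} (ρ : Op (Fin d × Fin d)) : Op (Fin d) :=
  Matrix.of fun k l => ∑ i, ρ (i, k) (i, l)

/-- The coherent information `I(A⟩B)_ρ = S(B)_ρ - S(AB)_ρ`. -/
def coherentInfo {d : ℕ} (ρ : Op (Fin d × Fin d)) : ℝ :=
  entropy (marginalB ρ) - entropy ρ

/-- The operator `|ψ⟩⟨φ|`. -/
def ketBra {n : Type*} (ψ φ : EuclideanSpace ℂ n) : Op n :=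
  Matrix.vecMulVec ψ.ofLp (star φ.ofLp)

/-- Maximally correlated states on `ℂ^d ⊗ ℂ^d`:
`ρ = ∑ i j, α i j |i⟩⟨j|_A ⊗ |i⟩⟨j|_B` for orthonormal bases of `A` and of `B` and a positive
semidefinite matrix `α` of trace one. -/
def IsMaxCorrelated {d : ℕ} (ρ : Op (Fin d × Fin d)) : Prop :=
  IsState ρ ∧
    ∃ (a b : OrthonormalBasis (Fin d) ℂ (EuclideanSpace ℂ (Fin d)))
      (α : Matrix (Fin d) (Fin d) ℂ),
      α.PosSemidef ∧ α.trace = 1 ∧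
        ρ = ∑ i, ∑ j, α i j • (ketBra (a i) (a j) ⊗ₖ ketBra (b i) (b j))

/-- The partial transpose on the `B` system. -/
def partialTransposeB {d : ℕ} (ρ : Op (Fin d × Fin d)) : Op (Fin d × Fin d) :=
  Matrix.of fun p q => ρ (p.1, q.2) (q.1, p.2)

/-- States with positive partial transpose. -/
def IsPPT {d : ℕ} (σ : Op (Fin d × Fin d)) : Prop :=
  IsState σ ∧ (partialTransposeB σ).PosSemidef

/-- The PPT-relative entropy of entanglement, the least value of `D(ρ‖σ)` over PPT states `σ`. -/
def relEntropyPPT {d : ℕ} (ρ : Op (Fin d × Fin d)) : EReal :=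
  ⨅ σ ∈ {σ : Op (Fin d × Fin d) | IsPPT σ}, relEntropy ρ σ

/-- The maximally entangled vector `|Φ⁺⟩ = d^(-1/2) ∑ i, |i⟩ ⊗ |i⟩`. -/
def maxEntVec (d : ℕ) : EuclideanSpace ℂ (Fin d × Fin d) :=
  WithLp.toLp 2 fun p => if p.1 = p.2 then ((1 / Real.sqrt d : ℝ) : ℂ) else 0

/-- The projector `Φ⁺ = |Φ⁺⟩⟨Φ⁺|`. -/
def maxEntProj (d : ℕ) : Op (Fin d × Fin d) :=
  ketBra (maxEntVec d) (maxEntVec d)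

/-- The overlap `⟨Φ⁺|ρ|Φ⁺⟩`. -/
def overlap {d : ℕ} (ρ : Op (Fin d × Fin d)) : ℂ :=
  star (maxEntVec d).ofLp ⬝ᵥ (ρ.mulVec (maxEntVec d).ofLp)

/-- The isotropic state `I_d(f) = f Φ⁺ + (1 - f) / (d² - 1) (1 - Φ⁺)`. -/
def isotropic (d : ℕ) (f : ℝ) : Op (Fin d × Fin d) :=
  (f : ℂ) • maxEntProj d + (((1 - f) / ((d : ℝ) ^ 2 - 1) : ℝ) : ℂ) • (1 - maxEntProj d)

/-- `φ_G(f)`: the infimum of `I(A⟩B)_ρ` over the maximally correlated states `ρ` on `ℂ^d ⊗ ℂ^d`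
with `⟨Φ⁺|ρ|Φ⁺⟩ = f`. -/
def phiG (d : ℕ) (f : ℝ) : EReal :=
  ⨅ ρ ∈ {ρ : Op (Fin d × Fin d) | IsMaxCorrelated ρ ∧ overlap ρ = (f : ℂ)},
    ((coherentInfo ρ : ℝ) : EReal)

/-- The binary entropy, to base 2. -/
def binaryEntropy (p : ℝ) : ℝ :=
  -p * Real.logb 2 p - (1 - p) * Real.logb 2 (1 - p)

end Entanglement

end

/-!
Both sides equal the binary relative entropy of `(m, 1 - m)` with respect to `(1 / d, 1 - 1 / d)`,
where `m = max f (1 / d)`. This function of `f` (`isoBound`) is convex: up to constants, the binary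
relative entropy is a negated `d`-ary entropy, which is convex, and increasing on `[1 / d, 1]`, and
it is composed with the convex function `f ↦ max f (1 / d)`.

The two lower bounds are one. The coherent information of a maximally correlated state is its
relative entropy to its dephasing in the correlated bases, and this dephasing is PPT
(`relEntropy_corrIso_diagonal`, `isPPT_corrIso_diagonal`). A PPT state has overlap at most `1 / d`
with `Φ⁺` (`overlap_re_le_of_isPPT`). So it is enough to bound `D(ρ‖σ)` from below when `ρ` has
overlap `f` and `σ` has overlap at most `1 / d` with `Φ⁺` (`isoBound_le_relEntropy`). For
`f ≤ 1 / d` this is Klein's inequality, and for `f ≥ 1 / d` it is the monotonicity of the relative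
entropy under the measurement `{Φ⁺, 1 - Φ⁺}` (`binary_relEntropy_le_trace`).

Monotonicity under a measurement has an elementary proof. With spectral decompositions
`ρ = ∑ r_i P_i` and `σ = ∑ s_k Q_k`, one has
`D(ρ‖σ) = ∑ tr(P_i Q_k) r_i (log r_i - log s_k)`, and the logarithm is obtained by integrating over
`t > 0` the resolvent terms `tr(P_i Q_k) r_i ^ 2 / (s_k + t r_i)`. By completing a square, the sum
of these is at least `2 tr(ρ C) - tr(σ C²) - t tr(ρ C²)` for every Hermitian `C`
(`resolvent_term_bound`); choosing `C` in the span of the measurement operators gives the resolvent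
terms of the classical relative entropy (`sum_mul_log_le_of_resolvent_le`,
`sum_mul_logb_le_trace`).

The bounds are attained by isotropic states on the PPT side (`exists_isPPT_relEntropy_eq`), and on
the maximally correlated side by mixtures of `Φ⁺` with the projector onto the rest of the span of
the vectors `|i⟩ ⊗ |i⟩` if `f ≥ 1 / d`, and by product vectors if `f ≤ 1 / d`
(`exists_isMaxCorrelated_coherentInfo_eq`).
-/

namespace Entanglement

open Matrix

/-! ### Rank-one operators -/

section KetBra

theorem ketBra_isHermitian {n : Type*} (x : EuclideanSpace ℂ n) : (ketBra x x).IsHermitian := by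
  simp [ketBra, IsHermitian, conjTranspose_vecMulVec]

variable {n : Type*} [Fintype n]

theorem ketBra_posSemidef (x : EuclideanSpace ℂ n) : (ketBra x x).PosSemidef :=
  posSemidef_vecMulVec_self_star _

theorem ketBra_mul_ketBra (a b c e : EuclideanSpace ℂ n) :
    ketBra a b * ketBra c e = inner ℂ b c • ketBra a e := by
  simp only [ketBra, vecMulVec_mul_vecMulVec, EuclideanSpace.inner_eq_star_dotProduct]
  rw [dotProduct_comm]
  ext i j
  simp [vecMulVec_apply]
  ring

theorem trace_ketBra (a b : EuclideanSpace ℂ n) : (ketBra a b).trace = inner ℂ b a := by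
  rw [ketBra, trace_vecMulVec, EuclideanSpace.inner_eq_star_dotProduct]

end KetBra

/-! ### Functional calculus through spectral decompositions -/

section FunctionalCalculus

theorem isHermitian_sum_smul {n ι : Type*} [Fintype ι] {P : ι → Op n}
    (hH : ∀ i, (P i).IsHermitian) (c : ι → ℝ) : (∑ i, c i • P i).IsHermitian := by
  simp only [IsHermitian, conjTranspose_sum, conjTranspose_smul, star_trivial]
  exact Finset.sum_congr rfl fun i _ => by rw [(hH i).eq]

variable {n ι : Type*} [Fintype n] [DecidableEq n] [Fintype ι]

/-- The algebra homomorphism sending a family of coefficients to the operator with these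
coefficients on a complete family of orthogonal idempotents. -/
noncomputable def diagAlgHom {P : ι → Op n} (hP : CompleteOrthogonalIdempotents P) :
    (ι → ℝ) →ₐ[ℝ] Op n :=
  AlgHom.ofLinearMap
    { toFun := fun c => ∑ i, c i • P i
      map_add' := fun x y => by simp [add_smul, Finset.sum_add_distrib]
      map_smul' := fun r x => by simp [mul_smul, Finset.smul_sum] }
    (by simpa using hP.complete)
    (fun x y => by
      classical
      simp only [LinearMap.coe_mk, AddHom.coe_mk, Finset.sum_mul, Finset.mul_sum,
        smul_mul_smul_comm, hP.mul_eq, Pi.mul_apply]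
      simp)

theorem diagAlgHom_apply {P : ι → Op n} (hP : CompleteOrthogonalIdempotents P) (c : ι → ℝ) :
    diagAlgHom hP c = ∑ i, c i • P i := rfl

/-- The functional calculus acts on an operator with a given spectral decomposition by acting on
the coefficients. -/
theorem cfc_sum_smul {P : ι → Op n} (hP : CompleteOrthogonalIdempotents P)
    (hH : ∀ i, (P i).IsHermitian) (c : ι → ℝ) (g : ℝ → ℝ) :
    cfc g (∑ i, c i • P i) = ∑ i, g (c i) • P i := by
  classical
  have hX : IsSelfAdjoint (∑ i, c i • P i) := isHermitian_sum_smul hH c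
  -- Only the values of `g` on the finitely many coefficients matter, so `g` may be replaced
  -- by an interpolating polynomial.
  set p := Lagrange.interpolate (Finset.univ.image c) id g with hp
  have hpc : ∀ i, p.eval (c i) = g (c i) := fun i =>
    Lagrange.eval_interpolate_at_node (v := id) g (Set.injOn_id _)
      (Finset.mem_image_of_mem c (Finset.mem_univ i))
  have hspec : spectrum ℝ (∑ i, c i • P i) ⊆ Set.range c := by
    refine (AlgHom.spectrum_apply_subset (diagAlgHom hP) c).trans ?_
    rw [Pi.spectrum_eq]
    intro x hx
    simp only [Set.mem_iUnion] at hx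
    obtain ⟨i, hi⟩ := hx
    rw [show c i = algebraMap ℝ ℝ (c i) from rfl, spectrum.scalar_eq (𝕜 := ℝ)] at hi
    exact ⟨i, hi.symm⟩
  rw [cfc_congr (g := p.eval) (fun x hx => by obtain ⟨i, rfl⟩ := hspec hx; exact (hpc i).symm),
    cfc_polynomial p _ hX, ← diagAlgHom_apply hP, Polynomial.aeval_algHom_apply, diagAlgHom_apply]
  exact Finset.sum_congr rfl fun i _ => by
    simp [← hpc i]

theorem sum_ketBra_eq_one [DecidableEq ι] (e : OrthonormalBasis ι ℂ (EuclideanSpace ℂ n)) :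
    ∑ i, ketBra (e i) (e i) = 1 := by
  refine Matrix.ext_of_mulVec_single fun j => ?_
  have := congrArg (fun x => x.ofLp) (e.sum_repr (EuclideanSpace.single j (1 : ℂ)))
  simp only [e.repr_apply_apply] at this
  rw [one_mulVec, sum_mulVec]
  ext k
  have h2 := congrFun this k
  simp only [WithLp.ofLp_sum, WithLp.ofLp_smul, Finset.sum_apply, Pi.smul_apply, smul_eq_mul] at h2
  change _ = (EuclideanSpace.single j (1 : ℂ)).ofLp k
  rw [← h2]
  simp [ketBra, vecMulVec_apply, Finset.sum_apply, EuclideanSpace.inner_single_right, mul_comm]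

theorem completeOrthogonalIdempotents_ketBra [DecidableEq ι]
    (e : OrthonormalBasis ι ℂ (EuclideanSpace ℂ n)) :
    CompleteOrthogonalIdempotents fun i => ketBra (e i) (e i) where
  idem i := by
    simp [IsIdempotentElem, ketBra_mul_ketBra]
  ortho i j hij := by
    simp [ketBra_mul_ketBra, e.inner_eq_zero hij]
  complete := sum_ketBra_eq_one e

/-- The spectral theorem, with the spectral family given by rank-one projections. -/
theorem eq_sum_eigenvalues_smul_ketBra {A : Op n} (hA : A.IsHermitian) :
    A = ∑ i, hA.eigenvalues i • ketBra (hA.eigenvectorBasis i) (hA.eigenvectorBasis i) := by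
  conv_lhs => rw [← mul_one A, ← sum_ketBra_eq_one hA.eigenvectorBasis, Finset.mul_sum]
  refine Finset.sum_congr rfl fun i _ => ?_
  rw [ketBra, mul_vecMulVec, hA.mulVec_eigenvectorBasis, smul_vecMulVec]

/-- The functional calculus commutes with conjugation by an isometry `V` as soon as the function
vanishes at `0`, which is then its value on the complement of the range of `V`. -/
theorem cfc_isometry_conj {m : Type*} [Fintype m] [DecidableEq m] {V : Matrix m n ℂ}
    (hV : Vᴴ * V = 1) {A : Op n} (hA : A.IsHermitian) {g : ℝ → ℝ} (hg : g 0 = 0) :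
    cfc g (V * A * Vᴴ) = V * cfc g A * Vᴴ := by
  classical
  set e := hA.eigenvectorBasis
  set P : n → Op n := fun i => ketBra (e i) (e i) with hPdef
  have hP : CompleteOrthogonalIdempotents P := completeOrthogonalIdempotents_ketBra e
  have hmul : ∀ X Y : Op n, (V * X * Vᴴ) * (V * Y * Vᴴ) = V * (X * Y) * Vᴴ := fun X Y => by
    rw [show (V * X * Vᴴ) * (V * Y * Vᴴ) = V * X * (Vᴴ * V) * Y * Vᴴ by
      simp only [Matrix.mul_assoc], hV, Matrix.mul_one, Matrix.mul_assoc V]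
  have hVV : (V * Vᴴ) * (V * Vᴴ) = V * Vᴴ := by simpa using hmul 1 1
  -- The spectral family of `V * A * Vᴴ`, completed by the projection onto the complement of the
  -- range of `V`.
  let Q : Option n → Op m := fun o => o.elim (1 - V * Vᴴ) fun i => V * P i * Vᴴ
  have h1 : ∀ X : Op n, (1 - V * Vᴴ) * (V * X * Vᴴ) = 0 := fun X => by
    have := hmul 1 X
    simp only [Matrix.mul_one, Matrix.one_mul] at this
    rw [Matrix.sub_mul, this, Matrix.one_mul, sub_self]
  have h2 : ∀ X : Op n, (V * X * Vᴴ) * (1 - V * Vᴴ) = 0 := fun X => by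
    have := hmul X 1
    simp only [Matrix.mul_one] at this
    rw [Matrix.mul_sub, this, Matrix.mul_one, sub_self]
  have hQ : CompleteOrthogonalIdempotents Q :=
    { idem := by
        rintro (_ | i)
        · have := h1 1
          simp only [Matrix.mul_one] at this
          simp [Q, IsIdempotentElem, Matrix.mul_sub, this]
        · simp [Q, IsIdempotentElem, hmul, (hP.idem i).eq]
      ortho := by
        rintro (_ | i) (_ | j) hij
        · exact absurd rfl hij
        · exact h1 _
        · exact h2 _
        · have : P i * P j = 0 := hP.ortho fun h => hij (congrArg some h)
          simp [Q, hmul, this]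
      complete := by
        simp [Fintype.sum_option, Q, ← Matrix.sum_mul, ← Matrix.mul_sum, hP.complete] }
  have hQH : ∀ o, (Q o).IsHermitian := by
    rintro (_ | i)
    · simp [Q, IsHermitian, conjTranspose_sub, conjTranspose_mul]
    · exact isHermitian_mul_mul_conjTranspose V (ketBra_isHermitian _)
  have hsum : ∀ c : n → ℝ, V * (∑ i, c i • P i) * Vᴴ = ∑ o, (o.elim 0 c : ℝ) • Q o := fun c => by
    simp [Fintype.sum_option, Q, Matrix.mul_sum, Matrix.sum_mul]
  rw [eq_sum_eigenvalues_smul_ketBra hA, cfc_sum_smul hP (fun i => ketBra_isHermitian _), hsum,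
    cfc_sum_smul hQ hQH, hsum]
  refine Finset.sum_congr rfl fun o _ => ?_
  cases o <;> simp [hg]

theorem cfc_diagonal (c : n → ℝ) (g : ℝ → ℝ) :
    cfc g (diagonal fun i => (c i : ℂ)) = diagonal fun i => (g (c i) : ℂ) := by
  have key : ∀ c : n → ℝ, diagonal (fun i => (c i : ℂ)) =
      ∑ i, c i • ketBra (EuclideanSpace.basisFun n ℂ i) (EuclideanSpace.basisFun n ℂ i) := by
    intro c
    ext i j
    simp [Matrix.sum_apply, ketBra, vecMulVec_apply, diagonal_apply, Pi.single_apply]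
    split_ifs with h <;> simp [h]
  rw [key, cfc_sum_smul (completeOrthogonalIdempotents_ketBra (EuclideanSpace.basisFun n ℂ))
    (fun i => ketBra_isHermitian _), ← key fun i => g (c i)]

end FunctionalCalculus

/-! ### From resolvents to logarithms -/

section Comparison

open Filter Topology

/-- A comparison of the resolvents of two finite families of likelihood ratios integrates to a
comparison of their relative entropies: `t ↦ r ^ 2 / (s + t * r)` is the derivative of
`t ↦ r * log (s + t * r)`, so the difference of the two sums of such logarithms increases from its
value at `t = 0` to its limit at infinity. -/
theorem sum_mul_log_le_of_resolvent_le {ι κ : Type*} [Fintype ι] [Fintype κ]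
    {p q : ι → ℝ} {w r s : κ → ℝ} (hp : ∀ i, 0 ≤ p i) (hq : ∀ i, 0 < q i)
    (hr : ∀ k, 0 ≤ r k) (hs : ∀ k, w k * r k ≠ 0 → 0 < s k)
    (hsum : ∑ i, p i = ∑ k, w k * r k)
    (h : ∀ t : ℝ, 0 < t →
      ∑ i, p i ^ 2 / (q i + t * p i) ≤ ∑ k, w k * (r k ^ 2 / (s k + t * r k))) :
    ∑ i, p i * (Real.log (p i) - Real.log (q i)) ≤
      ∑ k, w k * r k * (Real.log (r k) - Real.log (s k)) := by
  set H : ℝ → ℝ := fun t =>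
    ∑ k, w k * r k * Real.log (s k + t * r k) - ∑ i, p i * Real.log (q i + t * p i) with hH
  have hq' : ∀ i, ∀ t : ℝ, 0 ≤ t → 0 < q i + t * p i := fun i t ht =>
    add_pos_of_pos_of_nonneg (hq i) (mul_nonneg ht (hp i))
  have hder : ∀ t : ℝ, 0 ≤ t → HasDerivAt H
      (∑ k, w k * (r k ^ 2 / (s k + t * r k)) - ∑ i, p i ^ 2 / (q i + t * p i)) t := by
    intro t ht
    refine HasDerivAt.sub (HasDerivAt.fun_sum fun k _ => ?_) (HasDerivAt.fun_sum fun i _ => ?_)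
    · by_cases hk : w k * r k = 0
      · simp only [hk, zero_mul]
        rw [show w k * (r k ^ 2 / (s k + t * r k)) = (w k * r k) * (r k / (s k + t * r k)) by ring,
          hk, zero_mul]
        exact hasDerivAt_const _ _
      · have hpos : 0 < s k + t * r k :=
          add_pos_of_pos_of_nonneg (hs k hk) (mul_nonneg ht (hr k))
        have := (((hasDerivAt_id t).mul_const (r k)).const_add (s k)).log hpos.ne'
        refine (this.const_mul (w k * r k)).congr_deriv ?_
        simp only [id]
        ring
    · have := (((hasDerivAt_id t).mul_const (p i)).const_add (q i)).log (hq' i t ht).ne'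
      refine (this.const_mul (p i)).congr_deriv ?_
      simp only [id]
      ring
  have hmono : MonotoneOn H (Set.Ici 0) := by
    refine monotoneOn_of_deriv_nonneg (convex_Ici 0)
      (fun t ht => (hder t ht).continuousAt.continuousWithinAt)
      (fun t ht => (hder t (interior_subset ht)).differentiableAt.differentiableWithinAt)
      (fun t ht => ?_)
    rw [(hder t (interior_subset ht)).deriv, sub_nonneg]
    rw [interior_Ici] at ht
    exact h t ht
  have hterm : ∀ x y : ℝ, 0 < y →
      Tendsto (fun t : ℝ => Real.log (x + t * y) - Real.log t) atTop (𝓝 (Real.log y)) := by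
    intro x y hy
    have h1 : Tendsto (fun t : ℝ => x / t + y) atTop (𝓝 y) := by
      simpa using (tendsto_const_nhds (x := x)).div_atTop tendsto_id |>.add_const y
    refine (((Real.continuousAt_log hy.ne').tendsto).comp h1).congr' ?_
    filter_upwards [eventually_gt_atTop 0, h1.eventually (lt_mem_nhds hy)] with t ht ht2
    have : x + t * y = t * (x / t + y) := by field_simp
    rw [Function.comp_apply, this, Real.log_mul ht.ne' ht2.ne', add_sub_cancel_left]
  have hlim : Tendsto H atTop
      (𝓝 (∑ k, w k * r k * Real.log (r k) - ∑ i, p i * Real.log (p i))) := by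
    have h1 : Tendsto (fun t : ℝ => ∑ k, w k * r k * (Real.log (s k + t * r k) - Real.log t)
        - ∑ i, p i * (Real.log (q i + t * p i) - Real.log t)) atTop
        (𝓝 (∑ k, w k * r k * Real.log (r k) - ∑ i, p i * Real.log (p i))) := by
      refine (tendsto_finsetSum _ fun k _ => ?_).sub (tendsto_finsetSum _ fun i _ => ?_)
      · rcases (hr k).eq_or_lt with hk | hk
        · simp [← hk]
        · exact (hterm _ _ hk).const_mul _
      · rcases (hp i).eq_or_lt with hi | hi
        · simp [← hi]
        · exact (hterm _ _ hi).const_mul _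
    refine h1.congr fun t => ?_
    simp only [hH, mul_sub, Finset.sum_sub_distrib, ← Finset.sum_mul, hsum]
    ring
  have hfin : H 0 ≤ ∑ k, w k * r k * Real.log (r k) - ∑ i, p i * Real.log (p i) :=
    ge_of_tendsto hlim <| (eventually_ge_atTop 0).mono fun t ht =>
      hmono Set.self_mem_Ici ht ht
  simp only [hH, zero_mul, add_zero] at hfin
  simp only [mul_sub, Finset.sum_sub_distrib]
  linarith

end Comparison

/-! ### Relative entropy and two-outcome measurements -/

section Measurement

variable {n : Type*} [Fintype n]

/-- The variational lower bound for one term of the spectral sum of a resolvent. -/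
theorem resolvent_term_bound {P Q C : Op n} (hP : P.IsHermitian) (hP2 : IsIdempotentElem P)
    (hQ : Q.IsHermitian) (hQ2 : IsIdempotentElem Q) (hC : C.IsHermitian) {r s t : ℝ}
    (hr : 0 ≤ r) (hs : 0 ≤ s) (ht : 0 < t) :
    2 * (r * (P * Q * C).trace.re) - (s + t * r) * (P * C * Q * C).trace.re ≤
      (P * Q).trace.re * (r ^ 2 / (s + t * r)) := by
  -- The trace of `Xᴴ * X` is nonnegative for `X = g • Q * P - Q * C * P`.
  have key : ∀ g : ℝ, 0 ≤ g ^ 2 * (P * Q).trace.re - 2 * g * (P * Q * C).trace.re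
      + (P * C * Q * C).trace.re := by
    intro g
    have hX := (posSemidef_conjTranspose_mul_self
      (((g : ℂ) • (Q * P) - Q * C * P : Op n))).trace_nonneg
    have hconj : (P * C * Q).trace.re = (P * Q * C).trace.re := by
      have : star (P * C * Q).trace = (P * Q * C).trace := by
        rw [← trace_conjTranspose, conjTranspose_mul, conjTranspose_mul, hP.eq, hQ.eq, hC.eq,
          ← Matrix.mul_assoc, trace_mul_cycle, trace_mul_cycle]
      rw [← this]; rfl
    have e1 : (P * Q * (Q * P)).trace = (P * Q).trace := by
      rw [Matrix.mul_assoc, ← Matrix.mul_assoc Q Q P, hQ2.eq, ← Matrix.mul_assoc, trace_mul_cycle,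
        hP2.eq]
    have e2 : (P * Q * (Q * C * P)).trace = (P * Q * C).trace := by
      rw [Matrix.mul_assoc Q C P, Matrix.mul_assoc P Q, ← Matrix.mul_assoc Q Q (C * P), hQ2.eq,
        trace_mul_comm, Matrix.mul_assoc Q, Matrix.mul_assoc C, hP2.eq, ← Matrix.mul_assoc,
        trace_mul_comm, ← Matrix.mul_assoc]
    have e3 : (P * (C * Q) * (Q * P)).trace = (P * C * Q).trace := by
      rw [trace_mul_comm, Matrix.mul_assoc Q P, ← Matrix.mul_assoc P P, hP2.eq, trace_mul_comm,
        Matrix.mul_assoc P, Matrix.mul_assoc C Q Q, hQ2.eq, Matrix.mul_assoc P C Q]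
    have e4 : (P * (C * Q) * (Q * C * P)).trace = (P * C * Q * C).trace := by
      rw [trace_mul_comm, Matrix.mul_assoc (Q * C) P, ← Matrix.mul_assoc P P, hP2.eq,
        trace_mul_comm, Matrix.mul_assoc P, Matrix.mul_assoc C Q, ← Matrix.mul_assoc Q Q, hQ2.eq]
      simp only [Matrix.mul_assoc]
    simp only [conjTranspose_sub, conjTranspose_smul, conjTranspose_mul, hP.eq, hQ.eq, hC.eq,
      Matrix.sub_mul, Matrix.mul_sub, Matrix.smul_mul, Matrix.mul_smul, trace_sub, trace_smul,
      e1, e2, e3, e4] at hX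
    have := (Complex.nonneg_iff.mp hX).1
    simp [hconj] at this
    linarith
  have hst : 0 ≤ s + t * r := add_nonneg hs (mul_nonneg ht.le hr)
  rcases hst.eq_or_lt with h0 | hpos
  · have hr0 : r = 0 := by nlinarith
    have hs0 : s = 0 := by rw [hr0] at h0; linarith
    simp [hr0, hs0]
  -- The optimal choice of `g`.
  · have := mul_nonneg hpos.le (key (r / (s + t * r)))
    have h1 : (s + t * r) * ((r / (s + t * r)) ^ 2 * (P * Q).trace.re
        - 2 * (r / (s + t * r)) * (P * Q * C).trace.re + (P * C * Q * C).trace.re) =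
        (P * Q).trace.re * (r ^ 2 / (s + t * r)) - 2 * (r * (P * Q * C).trace.re)
        + (s + t * r) * (P * C * Q * C).trace.re := by
      field_simp
    linarith

variable [DecidableEq n]

/-- The trace formula for the relative entropy in terms of the spectral decompositions. -/
theorem trace_mul_opLog_sub_opLog {ι κ : Type*} [Fintype ι] [Fintype κ] {P : ι → Op n}
    {Q : κ → Op n} (hP : CompleteOrthogonalIdempotents P) (hPH : ∀ i, (P i).IsHermitian)
    (hQ : CompleteOrthogonalIdempotents Q) (hQH : ∀ i, (Q i).IsHermitian) (r : ι → ℝ)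
    (s : κ → ℝ) :
    ((∑ i, r i • P i) * (opLog (∑ i, r i • P i) - opLog (∑ k, s k • Q k))).trace.re =
      ∑ x : ι × κ, (P x.1 * Q x.2).trace.re * r x.1 *
        (Real.logb 2 (r x.1) - Real.logb 2 (s x.2)) := by
  classical
  have h1 : (∑ i, r i • P i) * (∑ i, Real.logb 2 (r i) • P i) =
      ∑ i, ∑ k, (r i * Real.logb 2 (r i)) • (P i * Q k) := by
    simp only [← Finset.smul_sum, ← Finset.mul_sum, hQ.complete, mul_one, Finset.sum_mul]
    refine Finset.sum_congr rfl fun i _ => ?_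
    simp only [Finset.mul_sum, smul_mul_smul_comm, hP.mul_eq]
    simp
  have h2 : (∑ i, r i • P i) * (∑ k, Real.logb 2 (s k) • Q k) =
      ∑ i, ∑ k, (r i * Real.logb 2 (s k)) • (P i * Q k) := by
    simp only [Finset.sum_mul]
    exact Finset.sum_congr rfl fun i _ => by simp only [Finset.mul_sum, smul_mul_smul_comm]
  rw [opLog, opLog, cfc_sum_smul hP hPH, cfc_sum_smul hQ hQH, mul_sub, h1, h2,
    Fintype.sum_prod_type]
  simp only [trace_sub, trace_sum, trace_smul, Complex.sub_re, Complex.re_sum, Complex.smul_re,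
    smul_eq_mul, ← Finset.sum_sub_distrib]
  exact Finset.sum_congr rfl fun i _ => Finset.sum_congr rfl fun k _ => by ring

/-- Inclusion of kernels, columnwise: right annihilators of `σ` are right annihilators of `ρ`. -/
theorem mul_eq_zero_of_ker_le {ρ σ X : Op n}
    (hker : LinearMap.ker σ.mulVecLin ≤ LinearMap.ker ρ.mulVecLin) (h : σ * X = 0) :
    ρ * X = 0 := by
  refine Matrix.ext_of_mulVec_single fun j => ?_
  have h1 : σ *ᵥ (X *ᵥ Pi.single j 1) = 0 := by rw [mulVec_mulVec, h, zero_mulVec]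
  have h2 : ρ *ᵥ (X *ᵥ Pi.single j 1) = 0 := hker (by simpa using h1)
  rw [← mulVec_mulVec, h2, zero_mulVec]

/-- A lower bound on the relative entropy by a classical relative entropy, from Hermitian trial
operators `C` in the variational formula for the resolvent of the relative modular operator. -/
theorem sum_mul_logb_le_trace {ι : Type*} [Fintype ι] {ρ σ : Op n} (hρ : IsState ρ)
    (hσ : σ.PosSemidef) (hker : LinearMap.ker σ.mulVecLin ≤ LinearMap.ker ρ.mulVecLin)
    {p q : ι → ℝ} (hp : ∀ i, 0 ≤ p i) (hq : ∀ i, 0 < q i) (hp1 : ∑ i, p i = 1)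
    (h : ∀ t : ℝ, 0 < t → ∃ C : Op n, C.IsHermitian ∧
      ∑ i, p i ^ 2 / (q i + t * p i) ≤
        2 * (ρ * C).trace.re - (σ * (C * C)).trace.re - t * (ρ * (C * C)).trace.re) :
    ∑ i, p i * (Real.logb 2 (p i) - Real.logb 2 (q i)) ≤
      (ρ * (opLog ρ - opLog σ)).trace.re := by
  classical
  have hρH := hρ.1.isHermitian
  have hσH := hσ.isHermitian
  set r := hρH.eigenvalues
  set s := hσH.eigenvalues
  set P : n → Op n := fun i => ketBra (hρH.eigenvectorBasis i) (hρH.eigenvectorBasis i)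
  set Q : n → Op n := fun i => ketBra (hσH.eigenvectorBasis i) (hσH.eigenvectorBasis i)
  have hP : CompleteOrthogonalIdempotents P := completeOrthogonalIdempotents_ketBra _
  have hQ : CompleteOrthogonalIdempotents Q := completeOrthogonalIdempotents_ketBra _
  have hPH : ∀ i, (P i).IsHermitian := fun i => ketBra_isHermitian _
  have hQH : ∀ i, (Q i).IsHermitian := fun i => ketBra_isHermitian _
  have hρe : ρ = ∑ i, r i • P i := eq_sum_eigenvalues_smul_ketBra hρH
  have hσe : σ = ∑ i, s i • Q i := eq_sum_eigenvalues_smul_ketBra hσH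
  have hr : ∀ i, 0 ≤ r i := hρ.1.eigenvalues_nonneg
  have hs : ∀ i, 0 ≤ s i := hσ.eigenvalues_nonneg
  have hPρ : ∀ i, P i * ρ = r i • P i := fun i => by
    rw [hρe, Finset.mul_sum]
    simp [hP.mul_eq]
  have hσQ : ∀ k, σ * Q k = s k • Q k := fun k => by
    rw [hσe, Finset.sum_mul]
    simp [hQ.mul_eq]
  have key := sum_mul_log_le_of_resolvent_le (κ := n × n) (p := p) (q := q)
    (w := fun x => (P x.1 * Q x.2).trace.re) (r := fun x => r x.1) (s := fun x => s x.2) hp hq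
    (fun x => hr x.1) ?_ ?_ ?_
  · have hD := trace_mul_opLog_sub_opLog hP hPH hQ hQH r s
    rw [← hρe, ← hσe] at hD
    rw [hD]
    have := mul_le_mul_of_nonneg_left key (inv_nonneg.mpr (Real.log_pos one_lt_two).le)
    simp only [Finset.mul_sum] at this
    have hlog : ∀ a x y : ℝ, a * (Real.logb 2 x - Real.logb 2 y) =
        (Real.log 2)⁻¹ * (a * (Real.log x - Real.log y)) := fun a x y => by
      simp only [Real.logb]; ring
    simpa only [hlog] using this
  · -- On the kernel of `σ`, where the logarithm of the coefficient is a junk value, the weight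
    -- vanishes by the inclusion of supports.
    rintro ⟨i, k⟩ hw
    refine (hs k).lt_of_ne fun h0 => hw ?_
    have h1 : ρ * Q k = 0 := mul_eq_zero_of_ker_le hker (by rw [hσQ, ← h0, zero_smul])
    have h2 : r i • (P i * Q k) = 0 := by
      rw [← smul_mul_assoc, ← hPρ, Matrix.mul_assoc, h1, Matrix.mul_zero]
    have h3 := congrArg (fun X : Op n => X.trace.re) h2
    simp only [trace_smul, Complex.smul_re, smul_eq_mul, trace_zero, Complex.zero_re] at h3
    rw [mul_comm]
    exact h3
  · rw [hp1, ← Complex.one_re, ← hρ.2, hρe, Fintype.sum_prod_type]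
    simp only [trace_sum, trace_smul, Complex.re_sum, Complex.smul_re, smul_eq_mul,
      ← Finset.sum_mul]
    refine Finset.sum_congr rfl fun i _ => ?_
    rw [← Complex.re_sum, ← trace_sum, ← Finset.mul_sum, hQ.complete, mul_one, mul_comm]
  · intro t ht
    obtain ⟨C, hC, hCt⟩ := h t ht
    refine hCt.trans ?_
    have e1 : (ρ * C).trace.re = ∑ i, ∑ k, r i * (P i * Q k * C).trace.re := by
      conv_lhs => rw [hρe, Finset.sum_mul, trace_sum, Complex.re_sum]
      refine Finset.sum_congr rfl fun i _ => ?_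
      rw [← Finset.mul_sum, ← Complex.re_sum, ← trace_sum, ← Finset.sum_mul, ← Finset.mul_sum,
        hQ.complete, mul_one, smul_mul_assoc, trace_smul, Complex.smul_re, smul_eq_mul]
    have e2 : (ρ * (C * C)).trace.re = ∑ i, ∑ k, r i * (P i * C * Q k * C).trace.re := by
      conv_lhs => rw [hρe, Finset.sum_mul, trace_sum, Complex.re_sum]
      refine Finset.sum_congr rfl fun i _ => ?_
      rw [← Finset.mul_sum, ← Complex.re_sum, ← trace_sum, ← Finset.sum_mul, ← Finset.mul_sum,
        hQ.complete, mul_one, smul_mul_assoc, trace_smul, Complex.smul_re, smul_eq_mul,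
        Matrix.mul_assoc]
    have e3 : (σ * (C * C)).trace.re = ∑ i, ∑ k, s k * (P i * C * Q k * C).trace.re := by
      rw [Finset.sum_comm]
      have : (σ * (C * C)).trace = (C * σ * C).trace := by
        rw [← Matrix.mul_assoc, trace_mul_cycle]
      rw [this]
      conv_lhs => rw [hσe, Finset.mul_sum, Finset.sum_mul, trace_sum, Complex.re_sum]
      refine Finset.sum_congr rfl fun k _ => ?_
      rw [← Finset.mul_sum, ← Complex.re_sum, ← trace_sum, ← Finset.sum_mul, ← Finset.sum_mul,
        ← Finset.sum_mul, hP.complete, one_mul, mul_smul_comm, smul_mul_assoc, trace_smul,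
        Complex.smul_re, smul_eq_mul]
    rw [e1, e2, e3, Fintype.sum_prod_type, Finset.mul_sum, Finset.mul_sum,
      ← Finset.sum_sub_distrib, ← Finset.sum_sub_distrib]
    refine Finset.sum_le_sum fun i _ => ?_
    rw [Finset.mul_sum, Finset.mul_sum, ← Finset.sum_sub_distrib, ← Finset.sum_sub_distrib]
    refine Finset.sum_le_sum fun k _ => ?_
    have := resolvent_term_bound (hPH i) (hP.idem i) (hQH k) (hQ.idem k) hC (hr i) (hs k) ht
    linarith

/-- **Klein's inequality**: the relative entropy of two states is nonnegative. -/
theorem trace_mul_opLog_sub_opLog_nonneg {ρ σ : Op n} (hρ : IsState ρ) (hσ : IsState σ)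
    (hker : LinearMap.ker σ.mulVecLin ≤ LinearMap.ker ρ.mulVecLin) :
    0 ≤ (ρ * (opLog ρ - opLog σ)).trace.re := by
  have := sum_mul_logb_le_trace (ι := Unit) (p := fun _ => 1) (q := fun _ => 1) hρ hσ.1 hker
    (fun _ => zero_le_one) (fun _ => zero_lt_one) (by simp) fun t ht =>
      ⟨((1 / (1 + t) : ℝ) : ℂ) • 1, by simp [IsHermitian], by
        have : 1 + t ≠ 0 := by positivity
        simp only [mul_smul_comm, mul_one, smul_smul, trace_smul, hρ.2, hσ.2, smul_eq_mul,
          ← Complex.ofReal_mul, Complex.ofReal_re]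
        simp
        refine le_of_eq ?_
        field_simp
        ring⟩
  simpa using this

/-- Monotonicity of the relative entropy under the two-outcome measurement `{Π, 1 - Π}`, combined
with the monotonicity of the binary relative entropy in its second argument: the overlap of `σ` with
`Π` is only required to be separated from that of `ρ` by the threshold `q`. -/
theorem binary_relEntropy_le_trace {ρ σ E : Op n} (hρ : IsState ρ) (hσ : IsState σ)
    (hker : LinearMap.ker σ.mulVecLin ≤ LinearMap.ker ρ.mulVecLin) (hE : E.IsHermitian)
    (hE2 : IsIdempotentElem E) {f q : ℝ} (hq0 : 0 < q) (hq1 : q < 1) (hqf : q ≤ f) (hf1 : f ≤ 1)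
    (hρE : (ρ * E).trace.re = f) (hσE : (σ * E).trace.re ≤ q) :
    f * (Real.logb 2 f - Real.logb 2 q) + (1 - f) * (Real.logb 2 (1 - f) - Real.logb 2 (1 - q)) ≤
      (ρ * (opLog ρ - opLog σ)).trace.re := by
  have key := sum_mul_logb_le_trace (ι := Bool) (p := fun b => bif b then f else 1 - f)
    (q := fun b => bif b then q else 1 - q) hρ hσ.1 hker
    (by rintro (_ | _) <;> simp <;> linarith) (by rintro (_ | _) <;> simp <;> linarith)
    (by simp) fun t ht => ?_
  · simpa using key
  have hf : 0 < f := hq0.trans_le hqf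
  have hd0 : 0 < q + t * f := by positivity
  have hd1 : 0 < 1 - q + t * (1 - f) :=
    add_pos_of_pos_of_nonneg (sub_pos.mpr hq1) (mul_nonneg ht.le (sub_nonneg.mpr hf1))
  -- The optimal coefficients for the outcome distributions `(f, 1 - f)` and `(q, 1 - q)`.
  set c := f / (q + t * f) with hc
  set e := (1 - f) / (1 - q + t * (1 - f)) with he
  have he0 : 0 ≤ e := div_nonneg (sub_nonneg.mpr hf1) hd1.le
  -- This ordering lets the actual overlap of `σ` replace `q`, and is where `q ≤ f` is needed.
  have hec : e ≤ c := by
    rw [hc, he, div_le_div_iff₀ hd1 hd0]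
    nlinarith
  refine ⟨(c : ℂ) • E + (e : ℂ) • (1 - E), ?_, ?_⟩
  · simp [IsHermitian, conjTranspose_add, conjTranspose_smul, conjTranspose_sub, hE.eq]
  · have hEE : E * E = E := hE2
    have hsq : ((c : ℂ) • E + (e : ℂ) • (1 - E)) * ((c : ℂ) • E + (e : ℂ) • (1 - E)) =
        ((c ^ 2 : ℝ) : ℂ) • E + ((e ^ 2 : ℝ) : ℂ) • (1 - E) := by
      simp only [add_mul, mul_add, smul_mul_smul_comm, mul_sub, sub_mul, hEE, mul_one, one_mul,
        sub_self, smul_zero, sub_zero, add_zero, zero_add]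
      push_cast
      simp only [sq]
    have htr : ∀ (τ : Op n), IsState τ → ∀ x y : ℝ,
        (τ * ((x : ℂ) • E + (y : ℂ) • (1 - E))).trace.re =
          x * (τ * E).trace.re + y * (1 - (τ * E).trace.re) := fun τ hτ x y => by
      simp [mul_add, mul_sub, hτ.2]
    rw [hsq, htr ρ hρ, htr σ hσ, htr ρ hρ, hρE]
    simp only [Fintype.sum_bool, cond_true, cond_false]
    have h1 : f ^ 2 / (q + t * f) = 2 * (c * f) - c ^ 2 * (q + t * f) := by
      rw [hc]; field_simp; ring
    have h2 : (1 - f) ^ 2 / (1 - q + t * (1 - f)) =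
        2 * (e * (1 - f)) - e ^ 2 * (1 - q + t * (1 - f)) := by
      rw [he]; field_simp; ring
    have h3 : 0 ≤ (q - (σ * E).trace.re) * (c ^ 2 - e ^ 2) :=
      mul_nonneg (sub_nonneg.mpr hσE) (sub_nonneg.mpr (pow_le_pow_left₀ he0 hec 2))
    rw [h1, h2]
    linarith

end Measurement

/-! ### Entropies from spectral decompositions -/

section Entropy

theorem isHermitian_bool {n : Type*} [DecidableEq n] {E : Op n} (hE : E.IsHermitian) (b : Bool) :
    (bif b then E else 1 - E).IsHermitian := by
  cases b
  · exact isHermitian_one.sub hE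
  · exact hE

variable {n : Type*} [Fintype n] [DecidableEq n]

/-- The entropy is the Shannon entropy of the spectrum, counted with multiplicity. -/
theorem entropy_sum_smul {ι : Type*} [Fintype ι] {P : ι → Op n}
    (hP : CompleteOrthogonalIdempotents P) (hH : ∀ i, (P i).IsHermitian) (c : ι → ℝ) :
    entropy (∑ i, c i • P i) = -∑ i, c i * Real.logb 2 (c i) * (P i).trace.re := by
  classical
  rw [entropy, opLog, cfc_sum_smul hP hH, ← diagAlgHom_apply hP, ← diagAlgHom_apply hP, ← map_mul,
    diagAlgHom_apply]
  simp [trace_sum, Complex.re_sum]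

theorem entropy_isometry_conj {m : Type*} [Fintype m] [DecidableEq m] {V : Matrix m n ℂ}
    (hV : Vᴴ * V = 1) {A : Op n} (hA : A.IsHermitian) : entropy (V * A * Vᴴ) = entropy A := by
  rw [entropy, entropy, opLog, opLog, cfc_isometry_conj hV hA (by simp), Matrix.trace_mul_comm]
  rw [show V * cfc (Real.logb 2) A * Vᴴ * (V * A * Vᴴ) =
    V * cfc (Real.logb 2) A * (Vᴴ * V) * A * Vᴴ by simp only [Matrix.mul_assoc], hV,
    Matrix.mul_one, Matrix.mul_assoc V, trace_mul_cycle, hV, Matrix.one_mul, trace_mul_comm]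

theorem relEntropy_of_ker_le {ρ σ : Op n}
    (h : LinearMap.ker σ.mulVecLin ≤ LinearMap.ker ρ.mulVecLin) :
    relEntropy ρ σ = (((ρ * (opLog ρ - opLog σ)).trace.re : ℝ) : EReal) := if_pos h

theorem relEntropy_self (ρ : Op n) : relEntropy ρ ρ = 0 := by
  rw [relEntropy_of_ker_le le_rfl]
  simp

theorem completeOrthogonalIdempotents_bool {E : Op n} (hE : IsIdempotentElem E) :
    CompleteOrthogonalIdempotents fun b => bif b then E else 1 - E where
  idem := by
    rintro (_ | _)
    · exact hE.one_sub
    · exact hE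
  ortho := by
    have : E * E = E := hE
    rintro (_ | _) (_ | _) h
    · exact absurd rfl h
    · simp [sub_mul, this]
    · simp [mul_sub, this]
    · exact absurd rfl h
  complete := by simp

end Entropy

/-! ### Maximally correlated states -/

section MaxCorrelated

variable {d : ℕ}

/-- The isometry `|i⟩ ↦ |i⟩_A ⊗ |i⟩_B` attached to a pair of orthonormal bases. -/
noncomputable def corrIso (a b : OrthonormalBasis (Fin d) ℂ (EuclideanSpace ℂ (Fin d))) :
    Matrix (Fin d × Fin d) (Fin d) ℂ :=
  Matrix.of fun p i => a i p.1 * b i p.2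

theorem sum_mul_conj_eq (b : OrthonormalBasis (Fin d) ℂ (EuclideanSpace ℂ (Fin d))) (i j : Fin d) :
    ∑ x, b i x * star (b j x) = if i = j then 1 else 0 := by
  rw [if_congr (eq_comm (a := i)) rfl rfl, ← orthonormal_iff_ite.mp b.orthonormal j i,
    EuclideanSpace.inner_eq_star_dotProduct]
  rfl

theorem corrIso_conjTranspose_mul (a b : OrthonormalBasis (Fin d) ℂ (EuclideanSpace ℂ (Fin d))) :
    (corrIso a b)ᴴ * corrIso a b = 1 := by
  ext i j
  have : ((corrIso a b)ᴴ * corrIso a b) i j =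
      (∑ x, a j x * star (a i x)) * ∑ y, b j y * star (b i y) := by
    rw [Finset.sum_mul_sum, ← Fintype.sum_prod_type']
    simp only [mul_apply, conjTranspose_apply, corrIso, of_apply, star_mul']
    exact Finset.sum_congr rfl fun p _ => by ring
  rw [this, sum_mul_conj_eq, sum_mul_conj_eq, one_apply]
  by_cases h : i = j
  · simp [h]
  · simp [h, Ne.symm h]

theorem sum_ketBra_kronecker_eq (a b : OrthonormalBasis (Fin d) ℂ (EuclideanSpace ℂ (Fin d)))
    (α : Matrix (Fin d) (Fin d) ℂ) :
    ∑ i, ∑ j, α i j • (ketBra (a i) (a j) ⊗ₖ ketBra (b i) (b j)) =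
      corrIso a b * α * (corrIso a b)ᴴ := by
  ext p q
  simp only [Matrix.sum_apply, Matrix.smul_apply, kroneckerMap_apply, ketBra, vecMulVec_apply,
    mul_apply, conjTranspose_apply, corrIso, of_apply, star_mul', Finset.sum_mul, smul_eq_mul,
    Pi.star_apply]
  rw [Finset.sum_comm]
  exact Finset.sum_congr rfl fun i _ => Finset.sum_congr rfl fun j _ => by ring

/-- The marginal of a maximally correlated state only sees the diagonal of the coefficient
matrix. -/
theorem marginalB_corrIso (a b : OrthonormalBasis (Fin d) ℂ (EuclideanSpace ℂ (Fin d)))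
    (α : Matrix (Fin d) (Fin d) ℂ) :
    marginalB (corrIso a b * α * (corrIso a b)ᴴ) =
      (Matrix.of fun x i => b i x) * diagonal α.diag * (Matrix.of fun x i => b i x)ᴴ := by
  ext k l
  simp only [marginalB, of_apply, mul_apply, conjTranspose_apply, corrIso, star_mul',
    Finset.sum_mul, diagonal_apply, mul_ite, mul_zero, ite_mul,
    zero_mul, diag_apply]
  rw [Finset.sum_comm]
  refine Finset.sum_congr rfl fun j _ => ?_
  rw [Finset.sum_comm]
  have : ∀ i, ∑ x, a i x * b i k * α i j * (star (a j x) * star (b j l)) =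
      (b i k * α i j * star (b j l)) * if i = j then 1 else 0 := fun i => by
    rw [← sum_mul_conj_eq a i j, Finset.mul_sum]
    exact Finset.sum_congr rfl fun x _ => by ring
  simp only [this, mul_ite, mul_one, mul_zero, Finset.sum_ite_eq', Finset.mem_univ, if_true]

theorem isState_corrIso (a b : OrthonormalBasis (Fin d) ℂ (EuclideanSpace ℂ (Fin d)))
    {α : Matrix (Fin d) (Fin d) ℂ} (hα : IsState α) :
    IsState (corrIso a b * α * (corrIso a b)ᴴ) :=
  ⟨hα.1.mul_mul_conjTranspose_same _, by
    rw [trace_mul_cycle, corrIso_conjTranspose_mul, Matrix.one_mul, hα.2]⟩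

theorem isMaxCorrelated_corrIso (a b : OrthonormalBasis (Fin d) ℂ (EuclideanSpace ℂ (Fin d)))
    {α : Matrix (Fin d) (Fin d) ℂ} (hα : IsState α) :
    IsMaxCorrelated (corrIso a b * α * (corrIso a b)ᴴ) :=
  ⟨isState_corrIso a b hα, a, b, α, hα.1, hα.2, (sum_ketBra_kronecker_eq a b α).symm⟩

theorem diagonal_diag_eq_ofReal {α : Matrix (Fin d) (Fin d) ℂ} (hα : α.IsHermitian) :
    diagonal α.diag = diagonal fun i => ((α i i).re : ℂ) := by
  congr 1
  ext i
  exact (Complex.conj_eq_iff_re.mp (hα.apply i i)).symm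

theorem isState_diagonal_diag {α : Matrix (Fin d) (Fin d) ℂ} (hα : IsState α) :
    IsState (diagonal α.diag) :=
  ⟨PosSemidef.diagonal fun _ => hα.1.diag_nonneg, by rw [trace_diagonal]; exact hα.2⟩

theorem coherentInfo_corrIso (a b : OrthonormalBasis (Fin d) ℂ (EuclideanSpace ℂ (Fin d)))
    {α : Matrix (Fin d) (Fin d) ℂ} (hα : IsState α) :
    coherentInfo (corrIso a b * α * (corrIso a b)ᴴ) = entropy (diagonal α.diag) - entropy α := by
  have hB : (Matrix.of fun x i => b i x : Matrix (Fin d) (Fin d) ℂ)ᴴ *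
      (Matrix.of fun x i => b i x) = 1 := by
    ext i j
    rw [one_apply, ← if_congr (eq_comm (a := j)) rfl rfl, ← sum_mul_conj_eq b j i]
    simp [mul_apply, mul_comm]
  rw [coherentInfo, marginalB_corrIso, entropy_isometry_conj hB
    (isState_diagonal_diag hα).1.isHermitian,
    entropy_isometry_conj (corrIso_conjTranspose_mul a b) hα.1.isHermitian]

theorem ker_diagonal_diag_le {α : Matrix (Fin d) (Fin d) ℂ} (hα : α.PosSemidef) :
    LinearMap.ker (diagonal α.diag).mulVecLin ≤ LinearMap.ker α.mulVecLin := by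
  intro x hx
  simp only [LinearMap.mem_ker, mulVecLin_apply] at hx ⊢
  -- A vanishing diagonal entry of a positive semidefinite matrix forces its column to vanish.
  have hcol : ∀ i, x i ≠ 0 → ∀ k, α k i = 0 := by
    intro i hi k
    have h0 : α i i = 0 := by
      have := congrFun hx i
      simpa [mulVec_diagonal, hi] using this
    have h1 := (hα.dotProduct_mulVec_zero_iff (Pi.single i 1)).mp (by simpa using h0)
    simpa using congrFun h1 k
  ext k
  simp only [mulVec, dotProduct, Pi.zero_apply]
  refine Finset.sum_eq_zero fun i _ => ?_
  by_cases hi : x i = 0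
  · simp [hi]
  · simp [hcol i hi k]

/-- The coherent information of a maximally correlated state is its relative entropy to the state
dephased in the correlated bases. -/
theorem relEntropy_corrIso_diagonal
    (a b : OrthonormalBasis (Fin d) ℂ (EuclideanSpace ℂ (Fin d)))
    {α : Matrix (Fin d) (Fin d) ℂ} (hα : IsState α) :
    relEntropy (corrIso a b * α * (corrIso a b)ᴴ)
      (corrIso a b * diagonal α.diag * (corrIso a b)ᴴ) =
      (coherentInfo (corrIso a b * α * (corrIso a b)ᴴ) : EReal) := by
  set V := corrIso a b with hVdef
  have hV : Vᴴ * V = 1 := corrIso_conjTranspose_mul a b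
  rw [relEntropy_of_ker_le, coherentInfo_corrIso a b hα]
  · congr 1
    rw [Matrix.mul_sub, trace_sub, Complex.sub_re]
    have h1 : (V * α * Vᴴ * opLog (V * α * Vᴴ)).trace.re = -entropy α := by
      rw [← entropy_isometry_conj hV hα.1.isHermitian, entropy, neg_neg]
    have h2 : (V * α * Vᴴ * opLog (V * diagonal α.diag * Vᴴ)).trace.re =
        -entropy (diagonal α.diag) := by
      rw [opLog, cfc_isometry_conj hV (isState_diagonal_diag hα).1.isHermitian (by simp), entropy,
        opLog, neg_neg, diagonal_diag_eq_ofReal hα.1.isHermitian, cfc_diagonal,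
        ← diagonal_diag_eq_ofReal hα.1.isHermitian]
      rw [show ∀ D : Op (Fin d), V * α * Vᴴ * (V * D * Vᴴ) = V * (α * (Vᴴ * V) * D) * Vᴴ from
        fun D => by simp only [Matrix.mul_assoc], hV, trace_mul_cycle, hV, Matrix.mul_one,
        Matrix.one_mul]
      simp [trace, mul_diagonal]
    rw [h1, h2]
    ring
  · intro x hx
    simp only [LinearMap.mem_ker, mulVecLin_apply] at hx ⊢
    have h1 : diagonal α.diag *ᵥ (Vᴴ *ᵥ x) = 0 := by
      have := congrArg (fun y => Vᴴ *ᵥ y) hx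
      simp only [mulVec_mulVec, mulVec_zero] at this
      rwa [Matrix.mul_assoc, ← Matrix.mul_assoc, hV, Matrix.one_mul, ← mulVec_mulVec] at this
    have h2 : α *ᵥ (Vᴴ *ᵥ x) = 0 := ker_diagonal_diag_le hα.1 (by simpa using h1)
    rw [Matrix.mul_assoc, ← mulVec_mulVec, ← mulVec_mulVec, h2, mulVec_zero]

/-- The dephased state is PPT: its partial transpose replaces the basis of `B` by its complex
conjugate. -/
theorem isPPT_corrIso_diagonal (a b : OrthonormalBasis (Fin d) ℂ (EuclideanSpace ℂ (Fin d)))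
    {α : Matrix (Fin d) (Fin d) ℂ} (hα : IsState α) :
    IsPPT (corrIso a b * diagonal α.diag * (corrIso a b)ᴴ) := by
  refine ⟨isState_corrIso a b (isState_diagonal_diag hα), ?_⟩
  have : partialTransposeB (corrIso a b * diagonal α.diag * (corrIso a b)ᴴ) =
      (Matrix.of fun p i => a i p.1 * star (b i p.2)) * diagonal α.diag *
        (Matrix.of fun (p : Fin d × Fin d) i => a i p.1 * star (b i p.2))ᴴ := by
    ext p q
    simp only [partialTransposeB, corrIso, of_apply, mul_apply, diagonal_apply,
      conjTranspose_apply, star_mul', star_star, mul_ite, mul_zero, Finset.sum_ite_eq',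
      Finset.mem_univ, if_true]
    exact Finset.sum_congr rfl fun i _ => by ring
  rw [this]
  exact (isState_diagonal_diag hα).1.mul_mul_conjTranspose_same _

end MaxCorrelated

/-! ### Overlap with the maximally entangled state -/

section MaximallyEntangled

variable {d : ℕ}

theorem overlap_eq_trace (ρ : Op (Fin d × Fin d)) : overlap ρ = (ρ * maxEntProj d).trace := by
  rw [overlap, maxEntProj, ketBra, mul_vecMulVec, trace_vecMulVec, dotProduct_comm]

theorem maxEntProj_isHermitian (d : ℕ) : (maxEntProj d).IsHermitian := ketBra_isHermitian _

theorem inner_maxEntVec (hd : 0 < d) : inner ℂ (maxEntVec d) (maxEntVec d) = 1 := by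
  have h : (0 : ℝ) < d := by exact_mod_cast hd
  rw [EuclideanSpace.inner_eq_star_dotProduct, dotProduct, Fintype.sum_prod_type]
  simp only [maxEntVec, Pi.star_apply]
  simp [apply_ite, ite_mul]
  rw [← Complex.ofReal_natCast, ← mul_inv, ← Complex.ofReal_mul, Real.mul_self_sqrt h.le]
  simp [hd.ne']

theorem maxEntProj_idem (hd : 0 < d) : IsIdempotentElem (maxEntProj d) := by
  rw [IsIdempotentElem, maxEntProj, ketBra_mul_ketBra, inner_maxEntVec hd, one_smul]

theorem trace_maxEntProj (hd : 0 < d) : (maxEntProj d).trace = 1 := by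
  rw [maxEntProj, trace_ketBra, inner_maxEntVec hd]

theorem maxEntProj_apply (p q : Fin d × Fin d) :
    maxEntProj d p q = if p.1 = p.2 ∧ q.1 = q.2 then (1 / d : ℂ) else 0 := by
  have h : (0 : ℝ) ≤ d := d.cast_nonneg
  have h1 : ((1 / Real.sqrt d : ℝ) : ℂ) * ((1 / Real.sqrt d : ℝ) : ℂ) = 1 / d := by
    rw [← Complex.ofReal_mul, ← sq, div_pow, Real.sq_sqrt h]
    simp
  rw [maxEntProj, ketBra, vecMulVec_apply, ← h1]
  by_cases h2 : p.1 = p.2 <;> by_cases h3 : q.1 = q.2 <;>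
    simp [maxEntVec, h2, h3, -one_div]

theorem PosSemidef.re_apply_le {n : Type*} [Fintype n] {A : Op n} (hA : A.PosSemidef)
    (x y : n) : (A x y).re ≤ ((A x x).re + (A y y).re) / 2 := by
  classical
  have h := hA.re_dotProduct_nonneg (Pi.single x 1 - Pi.single y 1)
  have h2 : (A y x).re = (A x y).re := by rw [← hA.isHermitian.apply x y]; rfl
  simp [mulVec_sub, sub_dotProduct, dotProduct_sub, h2] at h
  linarith

/-- The overlap of a PPT state with the maximally entangled state is at most `1 / d`, because the
partial transpose of `Φ⁺` is the swap operator divided by `d`, whose eigenvalues are at most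
`1 / d`. -/
theorem overlap_re_le_of_isPPT (hd : 0 < d) {σ : Op (Fin d × Fin d)} (hσ : IsPPT σ) :
    (overlap σ).re ≤ 1 / d := by
  have h : (0 : ℝ) < d := by exact_mod_cast hd
  set τ := partialTransposeB σ with hτ
  have htr : ∑ i, ∑ j, (τ (i, j) (i, j)).re = 1 := by
    rw [← Complex.one_re, ← hσ.1.2, trace, Fintype.sum_prod_type, Complex.re_sum]
    simp only [Complex.re_sum]
    rfl
  have h1 : overlap σ = (1 / d : ℂ) * ∑ i, ∑ j, τ (i, j) (j, i) := by
    rw [overlap_eq_trace, trace, Fintype.sum_prod_type, Finset.mul_sum]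
    simp only [diag_apply, mul_apply, Fintype.sum_prod_type, maxEntProj_apply, hτ,
      partialTransposeB, of_apply]
    refine Finset.sum_congr rfl fun i _ => ?_
    rw [Finset.mul_sum]
    simp [ite_and, mul_comm]
  have h2 : (overlap σ).re = (1 / d : ℝ) * ∑ i, ∑ j, (τ (i, j) (j, i)).re := by
    rw [h1, show (1 / d : ℂ) = ((1 / d : ℝ) : ℂ) by push_cast; rfl, Complex.re_ofReal_mul,
      Complex.re_sum]
    simp only [Complex.re_sum]
  rw [h2]
  refine mul_le_of_le_one_right (by positivity) ?_
  calc ∑ i, ∑ j, (τ (i, j) (j, i)).re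
      ≤ ∑ i, ∑ j, ((τ (i, j) (i, j)).re + (τ (j, i) (j, i)).re) / 2 :=
        Finset.sum_le_sum fun i _ => Finset.sum_le_sum fun j _ =>
          PosSemidef.re_apply_le hσ.2 _ _
    _ = 1 := by
        simp only [add_div, Finset.sum_add_distrib]
        rw [Finset.sum_comm (f := fun i j => (τ (j, i) (j, i)).re / 2)]
        simp only [← Finset.sum_div]
        rw [htr]
        norm_num

end MaximallyEntangled

/-! ### Convexity of the common value -/

section Value

/-- The binary relative entropy of `(f, 1 - f)` with respect to `(1 / d, 1 - 1 / d)`. -/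
noncomputable def isoVal (d : ℕ) (f : ℝ) : ℝ :=
  Real.logb 2 d - (1 - f) * Real.logb 2 ((d : ℝ) - 1) - binaryEntropy f

/-- The common value of both sides: the binary relative entropy above the threshold `1 / d`, where
it vanishes, and zero below. -/
noncomputable def isoBound (d : ℕ) (f : ℝ) : ℝ := isoVal d (max f (1 / d))

theorem isoVal_eq {d : ℕ} (hd : 2 ≤ d) (f : ℝ) :
    f * (Real.logb 2 f - Real.logb 2 (1 / d)) +
      (1 - f) * (Real.logb 2 (1 - f) - Real.logb 2 (1 - 1 / d)) = isoVal d f := by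
  have h : (2 : ℝ) ≤ d := by exact_mod_cast hd
  have h1 : (1 : ℝ) - 1 / d = (d - 1) / d := by field_simp
  rw [h1, Real.logb_div (x := d - 1) (by linarith) (by linarith), one_div, Real.logb_inv, isoVal,
    binaryEntropy]
  ring

theorem isoVal_eq_qaryEntropy (d : ℕ) (f : ℝ) :
    isoVal d f = (Real.log 2)⁻¹ * (Real.log d - Real.qaryEntropy d (1 - f)) := by
  simp only [isoVal, binaryEntropy, Real.qaryEntropy,
    Real.binEntropy_eq_negMulLog_add_negMulLog_one_sub, Real.negMulLog, Real.logb]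
  push_cast
  ring_nf

theorem isoVal_threshold {d : ℕ} (hd : 2 ≤ d) : isoVal d (1 / d) = 0 := by
  rw [← isoVal_eq hd]; ring

theorem convexOn_isoVal (d : ℕ) : ConvexOn ℝ (Set.Icc 0 1) (isoVal d) := by
  have h : ConvexOn ℝ (Set.Icc 0 1) fun f : ℝ => -Real.qaryEntropy d (1 - f) := by
    refine ⟨convex_Icc 0 1, fun x hx y hy a b ha hb hab => ?_⟩
    have := (Real.strictConcaveOn_qaryEntropy (q := d)).concaveOn.2 (x := 1 - x) (y := 1 - y)
      ⟨by linarith [hx.2], by linarith [hx.1]⟩ ⟨by linarith [hy.2], by linarith [hy.1]⟩ ha hb hab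
    simp only [smul_eq_mul] at this ⊢
    rw [show 1 - (a * x + b * y) = a * (1 - x) + b * (1 - y) by linear_combination (-hab)]
    linarith
  refine ((h.add_const (Real.log d)).smul
    (inv_nonneg.mpr (Real.log_pos one_lt_two).le)).congr fun f _ => ?_
  rw [isoVal_eq_qaryEntropy]
  simp only [Pi.add_apply, smul_eq_mul]
  ring

theorem monotoneOn_isoVal {d : ℕ} (hd : 2 ≤ d) : MonotoneOn (isoVal d) (Set.Icc (1 / d) 1) := by
  intro x hx y hy hxy
  rw [isoVal_eq_qaryEntropy, isoVal_eq_qaryEntropy]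
  refine mul_le_mul_of_nonneg_left ?_ (inv_nonneg.mpr (Real.log_pos one_lt_two).le)
  have := (Real.qaryEntropy_strictMonoOn hd).monotoneOn
    (a := 1 - y) ⟨by linarith [hy.2], by linarith [hy.1]⟩
    (b := 1 - x) ⟨by linarith [hx.2], by linarith [hx.1]⟩ (by linarith)
  linarith

theorem convexOn_isoBound {d : ℕ} (hd : 2 ≤ d) : ConvexOn ℝ (Set.Icc 0 1) (isoBound d) := by
  have hd0 : (0 : ℝ) < 1 / d := by positivity
  have hd1 : (1 : ℝ) / d ≤ 1 := (div_le_one (by positivity)).mpr (by exact_mod_cast (by omega))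
  have hmem : ∀ x ∈ Set.Icc (0 : ℝ) 1, max x (1 / d) ∈ Set.Icc (1 / d : ℝ) 1 := fun x hx =>
    ⟨le_max_right _ _, max_le hx.2 hd1⟩
  have hsub : Set.Icc (1 / d : ℝ) 1 ⊆ Set.Icc 0 1 := Set.Icc_subset_Icc_left hd0.le
  refine ⟨convex_Icc 0 1, fun x hx y hy a b ha hb hab => ?_⟩
  have hxy := convex_Icc (0 : ℝ) 1 hx hy ha hb hab
  have hm := convex_Icc (1 / d : ℝ) 1 (hmem x hx) (hmem y hy) ha hb hab
  refine (monotoneOn_isoVal hd (hmem _ hxy) hm ?_).trans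
    ((convexOn_isoVal d).2 (hsub (hmem x hx)) (hsub (hmem y hy)) ha hb hab)
  exact ((convexOn_id convex_univ).sup (convexOn_const (1 / d : ℝ) convex_univ)).2
    (Set.mem_univ x) (Set.mem_univ y) ha hb hab

end Value

/-! ### Lower bounds -/

section LowerBound

variable {d : ℕ}

/-- The bound for states whose overlaps with `Φ⁺` are `f` and at most `1 / d`, from which both lower
bounds follow. -/
theorem isoBound_le_relEntropy (hd : 2 ≤ d) {f : ℝ} (hf1 : f ≤ 1) {ρ σ : Op (Fin d × Fin d)}
    (hρ : IsState ρ) (hρf : overlap ρ = (f : ℂ)) (hσ : IsPPT σ) :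
    (isoBound d f : EReal) ≤ relEntropy ρ σ := by
  by_cases hker : LinearMap.ker σ.mulVecLin ≤ LinearMap.ker ρ.mulVecLin
  swap
  · rw [relEntropy, if_neg hker]
    exact le_top
  rw [relEntropy_of_ker_le hker, EReal.coe_le_coe_iff, isoBound]
  have h2 : (2 : ℝ) ≤ d := by exact_mod_cast hd
  rcases le_total (1 / (d : ℝ)) f with hf | hf
  · rw [max_eq_left hf, ← isoVal_eq hd]
    refine binary_relEntropy_le_trace hρ hσ.1 hker (maxEntProj_isHermitian d)
      (maxEntProj_idem (by omega)) (by positivity) ?_ hf hf1 ?_ ?_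
    · rw [div_lt_one] <;> linarith
    · rw [← overlap_eq_trace, hρf, Complex.ofReal_re]
    · rw [← overlap_eq_trace]
      exact overlap_re_le_of_isPPT (by omega) hσ
  · rw [max_eq_right hf, isoVal_threshold hd]
    exact trace_mul_opLog_sub_opLog_nonneg hρ hσ.1 hker

theorem isoBound_le_coherentInfo (hd : 2 ≤ d) {f : ℝ} (hf1 : f ≤ 1) {ρ : Op (Fin d × Fin d)}
    (hρ : IsMaxCorrelated ρ) (hρf : overlap ρ = (f : ℂ)) : isoBound d f ≤ coherentInfo ρ := by
  obtain ⟨hst, a, b, α, hα, htr, rfl⟩ := hρ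
  rw [sum_ketBra_kronecker_eq] at *
  rw [← EReal.coe_le_coe_iff, ← relEntropy_corrIso_diagonal a b ⟨hα, htr⟩]
  exact isoBound_le_relEntropy hd hf1 hst hρf (isPPT_corrIso_diagonal a b ⟨hα, htr⟩)

end LowerBound

/-! ### Isotropic states and the optimal PPT states -/

section Isotropic

variable {d : ℕ}

/-- The eigenvalues of an isotropic state, on the range of `Φ⁺` and on its complement. -/
noncomputable def isoEig (d : ℕ) (f : ℝ) (b : Bool) : ℝ :=
  bif b then f else (1 - f) / ((d : ℝ) ^ 2 - 1)

theorem isotropic_eq_sum (d : ℕ) (f : ℝ) :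
    isotropic d f = ∑ b, isoEig d f b • (bif b then maxEntProj d else 1 - maxEntProj d) := by
  simp only [isotropic, isoEig, Fintype.sum_bool, cond_true, cond_false, Complex.coe_smul]

theorem trace_one_sub_maxEntProj (hd : 0 < d) :
    (1 - maxEntProj d).trace = ((d : ℂ) ^ 2 - 1) := by
  rw [trace_sub, trace_maxEntProj hd, trace_one]
  simp [sq]

theorem one_sub_posSemidef {n : Type*} [Fintype n] [DecidableEq n] {E : Op n} (hE : E.IsHermitian)
    (hE2 : IsIdempotentElem E) : (1 - E).PosSemidef := by
  have := posSemidef_conjTranspose_mul_self (1 - E)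
  rwa [(isHermitian_one.sub hE).eq, hE2.one_sub.eq] at this

theorem isState_isotropic (hd : 2 ≤ d) {f : ℝ} (hf : f ∈ Set.Icc (0 : ℝ) 1) :
    IsState (isotropic d f) := by
  have h2 : (2 : ℝ) ≤ d := by exact_mod_cast hd
  have h3 : (0 : ℝ) < (d : ℝ) ^ 2 - 1 := by nlinarith
  constructor
  · refine ((ketBra_posSemidef _).smul (Complex.zero_le_real.mpr hf.1)).add
      ((one_sub_posSemidef (maxEntProj_isHermitian d) (maxEntProj_idem (by omega))).smul
        (Complex.zero_le_real.mpr (div_nonneg (sub_nonneg.mpr hf.2) h3.le)))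
  · rw [isotropic, trace_add, trace_smul, trace_smul, trace_maxEntProj (by omega),
      trace_one_sub_maxEntProj (by omega), show ((d : ℂ) ^ 2 - 1) = (((d : ℝ) ^ 2 - 1 : ℝ) : ℂ) by
        push_cast; rfl, smul_eq_mul, smul_eq_mul, ← Complex.ofReal_mul, div_mul_cancel₀ _ h3.ne']
    push_cast
    ring

theorem overlap_isotropic (hd : 0 < d) (f : ℝ) : overlap (isotropic d f) = (f : ℂ) := by
  have h : maxEntProj d * maxEntProj d = maxEntProj d := maxEntProj_idem hd
  rw [overlap_eq_trace, isotropic, add_mul, smul_mul_assoc, smul_mul_assoc, sub_mul, one_mul, h,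
    sub_self, smul_zero, add_zero, trace_smul, trace_maxEntProj hd, smul_eq_mul, mul_one]

/-- Two isotropic states commute, so their relative entropy is classical; the multiplicity
`d ^ 2 - 1` cancels. -/
theorem relEntropy_isotropic (hd : 2 ≤ d) (f : ℝ) {q : ℝ} (hq0 : 0 < q) (hq1 : q < 1) :
    relEntropy (isotropic d f) (isotropic d q) =
      ((f * (Real.logb 2 f - Real.logb 2 q) +
        (1 - f) * (Real.logb 2 (1 - f) - Real.logb 2 (1 - q)) : ℝ) : EReal) := by
  have h2 : (2 : ℝ) ≤ d := by exact_mod_cast hd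
  have h3 : (0 : ℝ) < (d : ℝ) ^ 2 - 1 := by nlinarith
  have hP := completeOrthogonalIdempotents_bool (maxEntProj_idem (d := d) (by omega))
  have hH := isHermitian_bool (maxEntProj_isHermitian d)
  have hEE : maxEntProj d * maxEntProj d = maxEntProj d := maxEntProj_idem (by omega)
  have hq : ∀ b, isoEig d q b ≠ 0 := by
    rintro (_ | _)
    · exact (div_pos (sub_pos.mpr hq1) h3).ne'
    · exact hq0.ne'
  rw [relEntropy_of_ker_le]
  · congr 1
    rw [isotropic_eq_sum, isotropic_eq_sum, trace_mul_opLog_sub_opLog hP hH hP hH,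
      Fintype.sum_prod_type]
    have htr : (1 - maxEntProj d).trace.re = (d : ℝ) ^ 2 - 1 := by
      rw [trace_one_sub_maxEntProj (by omega), show ((d : ℂ) ^ 2 - 1) =
        (((d : ℝ) ^ 2 - 1 : ℝ) : ℂ) by push_cast; rfl, Complex.ofReal_re]
    have hlog : ∀ x : ℝ, x ≠ 0 → Real.logb 2 (x / ((d : ℝ) ^ 2 - 1)) =
        Real.logb 2 x - Real.logb 2 ((d : ℝ) ^ 2 - 1) := fun x hx => Real.logb_div hx h3.ne'
    simp only [Fintype.sum_bool, cond_true, cond_false, isoEig, hEE, mul_sub, sub_mul, mul_one,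
      one_mul, sub_self, trace_zero, Complex.zero_re, zero_mul, add_zero, zero_add, sub_zero]
    rw [htr, trace_maxEntProj (by omega), Complex.one_re]
    rw [mul_div_cancel₀ _ h3.ne', hlog _ (sub_pos.mpr hq1).ne']
    by_cases hf : 1 - f = 0
    · rw [show f = 1 by linarith]
      simp
    · rw [hlog _ hf]
      ring
  · have hmul : diagAlgHom hP (fun b => isoEig d f b / isoEig d q b) * isotropic d q =
        isotropic d f := by
      rw [isotropic_eq_sum, isotropic_eq_sum, ← diagAlgHom_apply hP, ← diagAlgHom_apply hP,
        ← map_mul]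
      congr 1
      ext b
      exact div_mul_cancel₀ _ (hq b)
    intro x hx
    simp only [LinearMap.mem_ker, mulVecLin_apply] at hx ⊢
    rw [← hmul, ← mulVec_mulVec, hx, mulVec_zero]

/-- The swap operator on `ℂ^d ⊗ ℂ^d`. -/
noncomputable def swapOp (d : ℕ) : Op (Fin d × Fin d) :=
  Matrix.of fun p q => if p.1 = q.2 ∧ p.2 = q.1 then 1 else 0

theorem swapOp_isHermitian (d : ℕ) : (swapOp d).IsHermitian := by
  ext p q
  simp only [swapOp, conjTranspose_apply, of_apply]
  rw [apply_ite star, star_one, star_zero]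
  exact if_congr (by rw [and_comm, eq_comm, eq_comm (a := q.1)]) rfl rfl

theorem swapOp_mul_self (d : ℕ) : swapOp d * swapOp d = 1 := by
  ext ⟨i, j⟩ ⟨k, l⟩
  simp only [mul_apply, swapOp, of_apply, Fintype.sum_prod_type, one_apply, Prod.mk.injEq, ite_and]
  simp [eq_comm]

theorem one_add_smul_swapOp_posSemidef (d : ℕ) {ε : ℝ} (hε : ε ^ 2 = 1) :
    (1 + ε • swapOp d).PosSemidef := by
  have h := (posSemidef_conjTranspose_mul_self (1 + ε • swapOp d)).smul
    (show (0 : ℝ) ≤ 1 / 2 by norm_num)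
  have h1 : (1 + ε • swapOp d)ᴴ * (1 + ε • swapOp d) = (2 : ℝ) • (1 + ε • swapOp d) := by
    rw [conjTranspose_add, conjTranspose_smul, (swapOp_isHermitian d).eq, star_trivial,
      conjTranspose_one, add_mul, mul_add, mul_add, smul_mul_smul_comm, swapOp_mul_self, ← sq ε, hε]
    simp only [one_mul, mul_one, one_smul, two_smul]
    abel
  rwa [h1, smul_smul, show (1 / 2 * 2 : ℝ) = 1 by norm_num, one_smul] at h

theorem one_mul_add_swapOp_posSemidef (d : ℕ) {x y : ℝ} (hxy : |y| ≤ x) :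
    (x • (1 : Op (Fin d × Fin d)) + y • swapOp d).PosSemidef := by
  have h := abs_le.mp hxy
  have e : x • (1 : Op (Fin d × Fin d)) + y • swapOp d =
      ((x + y) / 2) • (1 + (1 : ℝ) • swapOp d) + ((x - y) / 2) • (1 + (-1 : ℝ) • swapOp d) := by
    module
  rw [e]
  exact ((one_add_smul_swapOp_posSemidef d (by norm_num)).smul (by linarith)).add
    ((one_add_smul_swapOp_posSemidef d (by norm_num)).smul (by linarith))

/-- The isotropic states below the threshold `1 / d` are PPT. -/
theorem isPPT_isotropic (hd : 2 ≤ d) {f : ℝ} (hf0 : 0 ≤ f) (hf : f ≤ 1 / d) :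
    IsPPT (isotropic d f) := by
  have h2 : (2 : ℝ) ≤ d := by exact_mod_cast hd
  have h3 : (0 : ℝ) < (d : ℝ) ^ 2 - 1 := by nlinarith
  have hfd : f * d ≤ 1 := by rwa [le_div_iff₀ (by linarith)] at hf
  refine ⟨isState_isotropic hd ⟨hf0, hf.trans ?_⟩, ?_⟩
  · rw [div_le_one] <;> linarith
  set c := (1 - f) / ((d : ℝ) ^ 2 - 1) with hc
  have e : partialTransposeB (isotropic d f) =
      c • (1 : Op (Fin d × Fin d)) + ((f - c) / d) • swapOp d := by
    ext ⟨i, j⟩ ⟨k, l⟩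
    simp only [partialTransposeB, isotropic, of_apply, Matrix.add_apply, Matrix.smul_apply,
      Matrix.sub_apply, maxEntProj_apply, swapOp, one_apply, Prod.mk.injEq, ← hc]
    have e1 : (i = k ∧ l = j) = (i = k ∧ j = l) := by rw [eq_comm (a := l)]
    have e2 : (i = l ∧ k = j) = (i = l ∧ j = k) := by rw [eq_comm (a := k)]
    simp only [e1, e2]
    split_ifs <;> simp <;> ring
  rw [e]
  have hcv : c * ((d : ℝ) ^ 2 - 1) = 1 - f := div_mul_cancel₀ _ h3.ne'
  refine one_mul_add_swapOp_posSemidef d ?_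
  rw [abs_div, abs_of_pos (by linarith : (0 : ℝ) < d), div_le_iff₀ (by linarith), abs_le]
  have hc0 : 0 ≤ c := div_nonneg (by nlinarith) h3.le
  refine ⟨by nlinarith, ?_⟩
  have : c * (d + 1) * (d - 1) ≥ f * (d - 1) := by nlinarith
  have := le_of_mul_le_mul_right this (by linarith)
  linarith

theorem exists_isPPT_relEntropy_eq (hd : 2 ≤ d) {f : ℝ} (hf : f ∈ Set.Icc (0 : ℝ) 1) :
    ∃ σ, IsPPT σ ∧ relEntropy (isotropic d f) σ = (isoBound d f : EReal) := by
  have h2 : (2 : ℝ) ≤ d := by exact_mod_cast hd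
  rcases le_total (1 / (d : ℝ)) f with h | h
  · refine ⟨isotropic d (1 / d), isPPT_isotropic hd (by positivity) le_rfl, ?_⟩
    rw [relEntropy_isotropic hd f (by positivity) (by rw [div_lt_one] <;> linarith), isoVal_eq hd,
      isoBound, max_eq_left h]
  · refine ⟨isotropic d f, isPPT_isotropic hd hf.1 h, ?_⟩
    rw [relEntropy_self, isoBound, max_eq_right h, isoVal_threshold hd, EReal.coe_zero]

end Isotropic

/-! ### Optimal maximally correlated states -/

section Attained

variable {d : ℕ}

/-- The overlap of a maximally correlated state is a quadratic form in the coefficient matrix. -/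
theorem overlap_corrIso (a b : OrthonormalBasis (Fin d) ℂ (EuclideanSpace ℂ (Fin d)))
    (α : Matrix (Fin d) (Fin d) ℂ) :
    overlap (corrIso a b * α * (corrIso a b)ᴴ) =
      1 / d * (star (fun i => ∑ x, star (a i x * b i x)) ⬝ᵥ
        (α *ᵥ fun i => ∑ x, star (a i x * b i x))) := by
  set w : Fin d → ℂ := fun i => ∑ x, star (a i x * b i x) with hw
  have h : (0 : ℝ) ≤ d := d.cast_nonneg
  have h1 : ((1 / Real.sqrt d : ℝ) : ℂ) * ((1 / Real.sqrt d : ℝ) : ℂ) = 1 / d := by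
    rw [← Complex.ofReal_mul, ← sq, div_pow, Real.sq_sqrt h]
    simp
  have h2 : (corrIso a b)ᴴ *ᵥ (maxEntVec d).ofLp =
      ((1 / Real.sqrt d : ℝ) : ℂ) • w := by
    ext i
    simp only [mulVec, dotProduct, Fintype.sum_prod_type, conjTranspose_apply, corrIso, of_apply,
      maxEntVec, mul_ite, mul_zero, Finset.sum_ite_eq, Finset.mem_univ, if_true, Finset.mul_sum,
      Pi.smul_apply, smul_eq_mul, hw]
    exact Finset.sum_congr rfl fun x _ => mul_comm _ _
  rw [overlap, ← mulVec_mulVec, ← mulVec_mulVec, dotProduct_mulVec,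
    ← conjTranspose_conjTranspose (corrIso a b), ← star_mulVec, conjTranspose_conjTranspose, h2,
    star_smul, mulVec_smul, smul_dotProduct, dotProduct_smul, smul_smul, Complex.star_def,
    Complex.conj_ofReal, h1, smul_eq_mul]

/-- The projection onto the uniform superposition. -/
noncomputable def unifProj (d : ℕ) : Matrix (Fin d) (Fin d) ℂ := Matrix.of fun _ _ => (1 / d : ℂ)

theorem unifProj_isHermitian (d : ℕ) : (unifProj d).IsHermitian := by
  ext i j
  simp [unifProj]

theorem unifProj_idem (hd : 0 < d) : IsIdempotentElem (unifProj d) := by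
  have h : (d : ℂ) ≠ 0 := by exact_mod_cast hd.ne'
  ext i j
  simp [unifProj, mul_apply, h]

theorem trace_unifProj (hd : 0 < d) : (unifProj d).trace = 1 := by
  have h : (d : ℂ) ≠ 0 := by exact_mod_cast hd.ne'
  simp [unifProj, trace, h]

/-- The mixture of `Φ⁺` with the normalized projector onto its complement in the span of the
vectors `|i⟩ ⊗ |i⟩`. Its marginal is maximally mixed, and it is optimal for `f ≥ 1 / d`. -/
theorem exists_isMaxCorrelated_coherentInfo_eq_isoVal (hd : 2 ≤ d) {f : ℝ} (hf0 : 0 ≤ f)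
    (hf1 : f ≤ 1) :
    ∃ ρ : Op (Fin d × Fin d), IsMaxCorrelated ρ ∧ overlap ρ = (f : ℂ) ∧
      coherentInfo ρ = isoVal d f := by
  have h2 : (2 : ℝ) ≤ d := by exact_mod_cast hd
  have h3 : (0 : ℝ) < d - 1 := by linarith
  have hdC : (d : ℂ) ≠ 0 := by exact_mod_cast (by omega : d ≠ 0)
  have hE := unifProj_isHermitian d
  have hE2 := unifProj_idem (d := d) (by omega)
  have hPE : (unifProj d).PosSemidef := by
    have := posSemidef_conjTranspose_mul_self (unifProj d)
    rwa [hE.eq, hE2.eq] at this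
  set c : Bool → ℝ := fun b => bif b then f else (1 - f) / (d - 1) with hc
  set α : Matrix (Fin d) (Fin d) ℂ :=
    ∑ b, c b • (bif b then unifProj d else 1 - unifProj d) with hα
  have hα' : α = f • unifProj d + ((1 - f) / (d - 1)) • (1 - unifProj d) := by
    simp [hα, hc]
  have htr1 : (1 - unifProj d).trace = ((d - 1 : ℝ) : ℂ) := by
    rw [trace_sub, trace_unifProj (by omega), trace_one]
    simp
  have hst : IsState α := by
    rw [hα']
    refine ⟨(hPE.smul hf0).add ((one_sub_posSemidef hE hE2).smul
      (div_nonneg (sub_nonneg.mpr hf1) h3.le)), ?_⟩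
    rw [trace_add, trace_smul, trace_smul, trace_unifProj (by omega), htr1, Complex.real_smul,
      Complex.real_smul, ← Complex.ofReal_mul, div_mul_cancel₀ _ h3.ne']
    push_cast
    ring
  have hdiag : diagonal α.diag = ∑ _u : Unit, (1 / d : ℝ) • (1 : Matrix (Fin d) (Fin d) ℂ) := by
    have hd1 : (d : ℂ) - 1 ≠ 0 := by exact_mod_cast h3.ne'
    have : α.diag = fun _ => (1 / d : ℂ) := by
      ext i
      rw [hα']
      simp only [diag_apply, Matrix.add_apply, Matrix.smul_apply, Matrix.sub_apply, unifProj,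
        of_apply, one_apply_eq, Complex.real_smul]
      push_cast
      field_simp
      ring
    rw [this]
    ext i j
    simp [diagonal_apply, one_apply]
  set e := EuclideanSpace.basisFun (Fin d) ℂ with he
  refine ⟨corrIso e e * α * (corrIso e e)ᴴ, isMaxCorrelated_corrIso e e hst, ?_, ?_⟩
  · have hw : (fun i => ∑ x, star (e i x * e i x)) = fun _ : Fin d => (1 : ℂ) := by
      ext i
      rw [Finset.sum_eq_single i (fun x _ hx => by simp [he, hx]) (by simp)]
      simp [he]
    have hJ : unifProj d *ᵥ (fun _ => (1 : ℂ)) = fun _ => (1 : ℂ) := by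
      ext i
      simp [mulVec, dotProduct, unifProj, hdC]
    rw [overlap_corrIso, hw, hα', add_mulVec, smul_mulVec, smul_mulVec, sub_mulVec, hJ, one_mulVec,
      sub_self, smul_zero, add_zero]
    simp [dotProduct]
    field_simp
  · have hU : CompleteOrthogonalIdempotents fun _ : Unit => (1 : Matrix (Fin d) (Fin d) ℂ) :=
      { idem := fun _ => .one
        ortho := fun _ _ h => absurd rfl h
        complete := by simp }
    rw [coherentInfo_corrIso e e hst, hdiag, hα, entropy_sum_smul hU (fun _ => isHermitian_one),
      entropy_sum_smul (completeOrthogonalIdempotents_bool hE2) (isHermitian_bool hE)]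
    simp only [Fintype.sum_bool, hc, cond_true, cond_false, htr1,
      trace_unifProj (d := d) (by omega), Finset.univ_unique, Finset.sum_singleton, trace_one,
      Fintype.card_fin, Complex.one_re, Complex.ofReal_re, Complex.natCast_re]
    rw [mul_right_comm _ (Real.logb 2 _) ((d : ℝ) - 1), div_mul_cancel₀ _ h3.ne', isoVal,
      binaryEntropy, one_div, Real.logb_inv, mul_right_comm, inv_mul_cancel₀ (by linarith)]
    by_cases hf : 1 - f = 0
    · rw [show f = 1 by linarith]
      simp
    · rw [Real.logb_div hf h3.ne']
      ring

/-- Below the threshold, the overlap is attained by a product vector `a ⊗ b`, whose coherent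
information is zero. -/
theorem exists_isMaxCorrelated_coherentInfo_eq_zero (hd : 2 ≤ d) {f : ℝ} (hf0 : 0 ≤ f)
    (hf : f ≤ 1 / d) :
    ∃ ρ : Op (Fin d × Fin d), IsMaxCorrelated ρ ∧ overlap ρ = (f : ℂ) ∧ coherentInfo ρ = 0 := by
  have h2 : (2 : ℝ) ≤ d := by exact_mod_cast hd
  have hdC : (d : ℂ) ≠ 0 := by exact_mod_cast (by omega : d ≠ 0)
  have hfd : f * d ≤ 1 := by rwa [le_div_iff₀ (by linarith)] at hf
  have hfd0 : 0 ≤ f * d := by positivity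
  let i₀ : Fin d := ⟨0, by omega⟩
  let i₁ : Fin d := ⟨1, by omega⟩
  have hne : i₀ ≠ i₁ := by simp [i₀, i₁]
  set e := EuclideanSpace.basisFun (Fin d) ℂ with he
  -- The first vector of the second basis makes an angle with `|0⟩` of squared cosine `f * d`.
  set w : EuclideanSpace ℂ (Fin d) :=
    ((Real.sqrt (f * d) : ℝ) : ℂ) • e i₀ + ((Real.sqrt (1 - f * d) : ℝ) : ℂ) • e i₁ with hw
  have hww : inner ℂ w w = (1 : ℂ) := by
    have h00 : inner ℂ (e i₀) (e i₀) = (1 : ℂ) := by simp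
    have h11 : inner ℂ (e i₁) (e i₁) = (1 : ℂ) := by simp
    have h01 : inner ℂ (e i₀) (e i₁) = (0 : ℂ) := e.inner_eq_zero hne
    have h10 : inner ℂ (e i₁) (e i₀) = (0 : ℂ) := e.inner_eq_zero hne.symm
    simp only [hw, inner_add_left, inner_add_right, inner_smul_left, inner_smul_right, h00, h11,
      h01, h10, Complex.conj_ofReal, mul_zero, mul_one, add_zero, zero_add, ← Complex.ofReal_mul,
      ← Complex.ofReal_add, Real.mul_self_sqrt hfd0, Real.mul_self_sqrt (sub_nonneg.mpr hfd)]
    simp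
  have hv : Orthonormal ℂ (({i₀} : Set (Fin d)).domRestrict fun _ => w) := by
    rw [orthonormal_iff_ite]
    intro i j
    rw [if_pos (Subsingleton.elim i j)]
    exact hww
  obtain ⟨b, hb⟩ := hv.exists_orthonormalBasis_extension_of_card_eq (by simp)
  have hb0 : b i₀ = w := hb i₀ rfl
  set α : Matrix (Fin d) (Fin d) ℂ := diagonal (Pi.single i₀ 1) with hα
  have hst : IsState α :=
    ⟨PosSemidef.diagonal (by
      intro i
      by_cases h : i = i₀ <;> simp [h]), by simp [hα, trace_diagonal]⟩
  refine ⟨corrIso e b * α * (corrIso e b)ᴴ, isMaxCorrelated_corrIso e b hst, ?_, ?_⟩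
  · have hw0 : ∑ x, star (e i₀ x * b i₀ x) = ((Real.sqrt (f * d) : ℝ) : ℂ) := by
      rw [hb0, Finset.sum_eq_single i₀ (fun x _ hx => by simp [he, hx]) (by simp)]
      simp [he, hw, hne]
    rw [overlap_corrIso]
    simp only [hα, dotProduct, mulVec_diagonal, Pi.star_apply]
    rw [Finset.sum_eq_single i₀ (fun i _ hi => by simp [hi]) (by simp), hw0, Pi.single_eq_same,
      one_mul, Complex.star_def, Complex.conj_ofReal, ← Complex.ofReal_mul,
      Real.mul_self_sqrt hfd0]
    push_cast
    field_simp
  · rw [coherentInfo_corrIso e b hst, hα, diag_diagonal, sub_self]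

theorem exists_isMaxCorrelated_coherentInfo_eq (hd : 2 ≤ d) {f : ℝ}
    (hf : f ∈ Set.Icc (0 : ℝ) 1) :
    ∃ ρ : Op (Fin d × Fin d), IsMaxCorrelated ρ ∧ overlap ρ = (f : ℂ) ∧
      coherentInfo ρ = isoBound d f := by
  rcases le_total (1 / (d : ℝ)) f with h | h
  · rw [isoBound, max_eq_left h]
    exact exists_isMaxCorrelated_coherentInfo_eq_isoVal hd hf.1 hf.2
  · rw [isoBound, max_eq_right h, isoVal_threshold hd]
    exact exists_isMaxCorrelated_coherentInfo_eq_zero hd hf.1 h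

theorem phiG_eq (hd : 2 ≤ d) {f : ℝ} (hf : f ∈ Set.Icc (0 : ℝ) 1) :
    phiG d f = (isoBound d f : EReal) := by
  obtain ⟨ρ, hρ, hρf, hρv⟩ := exists_isMaxCorrelated_coherentInfo_eq hd hf
  refine le_antisymm ((iInf₂_le ρ ⟨hρ, hρf⟩).trans_eq (by rw [hρv])) (le_iInf₂ fun τ hτ => ?_)
  exact EReal.coe_le_coe_iff.mpr (isoBound_le_coherentInfo hd hf.2 hτ.1 hτ.2)

theorem relEntropyPPT_isotropic (hd : 2 ≤ d) {f : ℝ} (hf : f ∈ Set.Icc (0 : ℝ) 1) :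
    relEntropyPPT (isotropic d f) = (isoBound d f : EReal) := by
  obtain ⟨σ, hσ, hσv⟩ := exists_isPPT_relEntropy_eq hd hf
  refine le_antisymm ((iInf₂_le σ hσ).trans_eq hσv) (le_iInf₂ fun τ hτ => ?_)
  exact isoBound_le_relEntropy hd hf.2 (isState_isotropic hd hf)
    (overlap_isotropic (by omega) f) hτ

end Attained

end Entanglement

theorem mainTheorem10 (d : ℕ) (hd : 2 ≤ d) :
    (∀ f ∈ Set.Icc (0 : ℝ) 1,
      Entanglement.phiG d f = Entanglement.relEntropyPPT (Entanglement.isotropic d f) ∧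
      (∃ σ, Entanglement.IsPPT σ ∧
        Entanglement.relEntropy (Entanglement.isotropic d f) σ =
          Entanglement.relEntropyPPT (Entanglement.isotropic d f)) ∧
      (1 / (d : ℝ) ≤ f →
        Entanglement.relEntropyPPT (Entanglement.isotropic d f) =
          ((Real.logb 2 d - (1 - f) * Real.logb 2 ((d : ℝ) - 1)
            - Entanglement.binaryEntropy f : ℝ) : EReal)) ∧
      (f ≤ 1 / (d : ℝ) →
        Entanglement.relEntropyPPT (Entanglement.isotropic d f) = 0)) ∧
    ConvexOn ℝ (Set.Icc (0 : ℝ) 1) (fun f => (Entanglement.phiG d f).toReal) := by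
  refine ⟨fun f hf => ?_, ?_⟩
  · rw [Entanglement.phiG_eq hd hf, Entanglement.relEntropyPPT_isotropic hd hf]
    refine ⟨rfl, Entanglement.exists_isPPT_relEntropy_eq hd hf, fun h => ?_, fun h => ?_⟩
    · rw [Entanglement.isoBound, max_eq_left h, Entanglement.isoVal]
    · rw [Entanglement.isoBound, max_eq_right h, Entanglement.isoVal_threshold hd, EReal.coe_zero]
  · refine (Entanglement.convexOn_isoBound hd).congr fun f hf => ?_
    rw [Entanglement.phiG_eq hd hf, EReal.toReal_coe]
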